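/- **Setting.** There are one server (party $0$) and $M$ clients (parties $1,\dots,M$); party $m$ has parameters $w_m\in\mathbb R^{d_m}$, with $d_m\ge 1$ for every client, and we write ${\bf w}=(w_1,\dots,w_M)$. For samples $i=1,\dots,n$ with features $x_{i,m}$ held by client $m$ and labels $y_i$ held by the server, put $$f_i(w_0,{\bf w})=\mathcal L\bigl(F_0(w_0,F_1(w_1;x_{i,1}),\dots,F_M(w_M;x_{i,M})),y_i\bigr)+\lambda\sum_{m=0}^M g_m(w_m),\qquad f=\frac1n\sum_{i=1}^n f_i .$$ **Algorithm.** In round $t=0,1,2,\dots$ a client $m_t$ is activated, a sample $i_t$ is drawn (with some law $q$ on $\{1,\dots,n\}$), and a direction $u^t$ is drawn uniformly from the unit sphere of $\mathbb R^{d_{m_t}}$. The step uses the delayed parameters $\tilde{\bf w}^t=(w_1^{t-\tau^t_{i_t,1}},\dots,w_M^{t-\tau^t_{i_t,M}})$, where $w_m^s=w_m^0$ for $s<0$. With a common step size $\eta>0$ and smoothing parameters $\mu_m>0$, $$w_0^{t+1}=w_0^t-\eta\nabla_{w_0}f_{i_t}(w_0^t,\tilde{\bf w}^t),\qquad w_{m_t}^{t+1}=w_{m_t}^t-\eta\,\frac{d_{m_t}}{\mu_{m_t}}\bigl[f_{i_t}(w_0^t,\tilde{\bf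 w}^t+\mu_{m_t}u^t)-f_{i_t}(w_0^t,\tilde{\bf w}^t)\bigr]u^t,$$ where $\mu_{m_t}u^t$ is added to block $m_t$, and $w_m^{t+1}=w_m^t$ for the other clients. The delays $\tau^t_{i,m}$ may depend in any way on the past and on $m_t$; $m_t$ is independent of the past, $i_t$ is independent of the past and $m_t$, and the direction is independent of the past, $m_t$ and $i_t$. The initial parameters may be random, with $\mathbb E|f(w_0^0,{\bf w}^0)|<\infty$. **Assumptions.** 1. $f^*=\inf f>-\infty$. 2. Every $f_i$ is differentiable, $\nabla f_i$ is $L$-Lipschitz, and $\nabla_{w_m}f_i$ is $L_m$-Lipschitz as a function of all parameters, with $L_m>0$ for $m=0,\dots,M$. 3. $\mathbb E_i\nabla_{w_m}f_i=\nabla_{w_m}f$ for $m=0,\dots,M$, where $i\sim q$. 4. $\mathbb E_i\|\nabla_{w_m}f_i-\nabla_{w_m}f\|^2\le\sigma_m^2$ everywhere, with $\sigma_m\ge 0$, for $m=0,\dots,M$. 5. $\|\nabla_{w_m}f_i\|\le \mathbf G_m$ everywhere, with $\mathbf G_m>0$, for all $i$ and $m=1,\dots,M$. 6. $\mathbb P(m_t=m)=p_m>0$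 for all $t$ and $m=1,\dots,M$, and $m_t$ is independent of the past. 7. $\tau^t_{i,m}\le\tau$ almost surely for all $i$, $m\ge1$ and $t<T$. **Theorem.** Let $T\ge1$, $L_*=\max\{L,L_0,\dots,L_M\}$, $d_*=\max_{1\le m\le M}d_m$, $1/p_*=\min_m p_m$, $\mu_*=\max_m\mu_m$, $\sigma_*=\max_{0\le m\le M}\sigma_m$, $\mathbf G_*=\max_m\mathbf G_m$, and $\eta\le\frac1{4L_*d_*}$. Then $\mathbb E\|\nabla f(w_0^t,{\bf w}^t)\|^2$ is finite for all $t<T$, and $$\begin{aligned}\frac1T\sum_{t=0}^{T-1}\mathbb E\|\nabla f(w_0^t,{\bf w}^t)\|^2\le{}&\frac{4p_*\,\mathbb E\bigl(f(w_0^0,{\bf w}^0)-f^*\bigr)}{T\eta}+\eta\bigl(4p_*L_*\sigma_*^2+8p_*L_*d_*\sigma_*^2+p_*L_*^3\mu_*^2d_*^2\bigr)\\&+\eta^2\bigl(18p_*\tau^2L_*^2d_*\mathbf G_*^2+5p_*\tau^2L_*^4\mu_*^2d_*^2\bigr)+\mu_*^2\,p_*L_*^2d_*^2 .\end{aligned}$$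 In particular the bound depends on the dimensions only through $d_*$, not through $d_0$. -/

import Mathlib

open MeasureTheory ProbabilityTheory

noncomputable section

namespace VFL

/-- The joint parameter space `ℝ^{d 0} × ℝ^{d 1} × ⋯ × ℝ^{d M}` with its Euclidean norm.
Block `0` belongs to the server, block `m.succ` to client `m : Fin M`. -/
abbrev Params {M : ℕ} (d : Fin (M + 1) → ℕ) : Type :=
  PiLp 2 (fun m : Fin (M + 1) => EuclideanSpace ℝ (Fin (d m)))

/-- A vertical federated learning problem with `n` samples and `M` clients. Client `m` holds the
features `X m` of every sample and a model with values in its embedding space `C m`; the server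
holds the labels (in `Y`) and a model that sends the embeddings to a prediction (in `Z`). -/
structure Problem {M : ℕ} (n : ℕ) (d : Fin (M + 1) → ℕ) (X C : Fin M → Type*)
    (Z Y : Type*) where
  /-- `feature i m` is the part of sample `i` that client `m` holds. -/
  feature : Fin n → ∀ m : Fin M, X m
  /-- The labels. -/
  label : Fin n → Y
  /-- The local model of client `m`. -/
  clientModel : ∀ m : Fin M, EuclideanSpace ℝ (Fin (d m.succ)) → X m → C m
  /-- The model of the server. -/
  serverModel : EuclideanSpace ℝ (Fin (d 0)) → (∀ m : Fin M, C m) → Z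
  /-- The loss of a prediction against a label. -/
  loss : Z → Y → ℝ
  /-- The regularization weight. -/
  regWeight : ℝ
  /-- The regularizer of each party. -/
  reg : ∀ m : Fin (M + 1), EuclideanSpace ℝ (Fin (d m)) → ℝ

section

variable {M n : ℕ} {d : Fin (M + 1) → ℕ} {X C : Fin M → Type*} {Z Y : Type*}

/-- The loss `f_i` of sample `i` as a function of all parameters. -/
def Problem.sampleLoss (V : Problem n d X C Z Y) (i : Fin n) (w : Params d) : ℝ :=
  V.loss
      (V.serverModel (w 0) (fun m => V.clientModel m (w m.succ) (V.feature i m)))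
      (V.label i)
    + V.regWeight * ∑ m, V.reg m (w m)

/-- The objective `f = (1/n) ∑ f_i`. -/
def Problem.objective (V : Problem n d X C Z Y) (w : Params d) : ℝ :=
  (1 / (n : ℝ)) * ∑ i, V.sampleLoss i w

/-- The partial gradient `∇_{w_m} f (w)`: the block of the full gradient at party `m`. -/
def partialGrad (f : Params d → ℝ) (m : Fin (M + 1)) (w : Params d) :
    EuclideanSpace ℝ (Fin (d m)) :=
  (gradient f w) m

/-- The two-point zeroth-order estimator of `∇_{w_m} f (w)` for client `m`, with smoothing
parameter `μ` and direction `u`; the dimension factor `d m` is the one for directions that are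
uniform on the unit sphere. -/
def zoEstimator (f : Params d → ℝ) (μ : ℝ) (m : Fin M) (w : Params d)
    (u : EuclideanSpace ℝ (Fin (d m.succ))) : EuclideanSpace ℝ (Fin (d m.succ)) :=
  (((d m.succ : ℝ) / μ) * (f (w + PiLp.single 2 m.succ (μ • u)) - f w)) • u

end

/-- The uniform probability distribution on the unit sphere of `ℝ^k` (for `1 ≤ k`): normalized
surface measure, as a measure on `ℝ^k`. -/
def sphereUniform (k : ℕ) : Measure (EuclideanSpace ℝ (Fin k)) :=
  ((volume : Measure (EuclideanSpace ℝ (Fin k))).toSphere Set.univ)⁻¹ •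
    ((volume : Measure (EuclideanSpace ℝ (Fin k))).toSphere).map Subtype.val

/-- The parameters that the server has at hand in round `t`: its own current block `w_0^t`, and for
client `m` the block `w_m^{t - δ m}` that is `δ m` rounds old. Before round `0` the parameters
are the initial ones, which the truncated subtraction expresses. -/
def delayedParams {M : ℕ} {d : Fin (M + 1) → ℕ} (w : ℕ → Params d) (t : ℕ) (δ : Fin M → ℕ) :
    Params d :=
  WithLp.toLp 2 (Fin.cons (w t 0) (fun m : Fin M => w (t - δ m) m.succ))

/-- A run of the asynchronous algorithm with cascaded hybrid optimization: in round `t` one client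
`act t` is activated, a sample `sample t` is drawn, the activated client takes a two-point
zeroth-order step and the server takes a first-order step, both for that sample and both at the
delayed parameters. `ℱ t` is the information available before round `t`, `dir t m` is the
direction that client `m` uses if it is the activated one, and `delay t ω i m` is the age of the
parameters of client `m` behind the embedding of sample `i` used in round `t`. The delays
may depend in any way on the past and on the activated client. -/
structure Run {M n : ℕ} {d : Fin (M + 1) → ℕ} {X C : Fin M → Type*} {Z Y : Type*}
    (V : Problem n d X C Z Y) (η : ℝ) (μ : Fin M → ℝ) (p : Fin M → ℝ) (q : Fin n → ℝ)
    {Ω : Type*} [mΩ : MeasurableSpace Ω] (P : Measure Ω) (ℱ : Filtration ℕ mΩ)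
    (act : ℕ → Ω → Fin M) (sample : ℕ → Ω → Fin n)
    (dir : ℕ → Ω → ∀ m : Fin M, EuclideanSpace ℝ (Fin (d m.succ)))
    (delay : ℕ → Ω → Fin n → Fin M → ℕ)
    (w : ℕ → Ω → Params d) : Prop where
  /-- The state before round `t` is part of the information at `t`. -/
  adapted : ∀ t, Measurable[ℱ t] (w t)
  /-- The random choices of round `t` belong to the information after that round. -/
  measurable_act : ∀ t, Measurable[ℱ (t + 1)] (act t)
  measurable_sample : ∀ t, Measurable[ℱ (t + 1)] (sample t)
  measurable_dir : ∀ t m, Measurable[ℱ (t + 1)] (fun ω => dir t ω m)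
  /-- The delays are determined by the past and the activated client. -/
  measurable_delay : ∀ t i m,
    Measurable[ℱ t ⊔ MeasurableSpace.comap (act t) ⊤] (fun ω => delay t ω i m)
  /-- The activated client has law `p` and is independent of the past. -/
  law_act : ∀ t m, P.real {ω | act t ω = m} = p m
  indep_act : ∀ t, Indep (MeasurableSpace.comap (act t) ⊤) (ℱ t) P
  /-- The sample has law `q` and is independent of the past and of the activated client. -/
  law_sample : ∀ t i, P.real {ω | sample t ω = i} = q i
  indep_sample : ∀ t, Indep (MeasurableSpace.comap (sample t) ⊤)
    (ℱ t ⊔ MeasurableSpace.comap (act t) ⊤) P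
  /-- The direction is uniform on the unit sphere and independent of everything else. -/
  law_dir : ∀ t m, P.map (fun ω => dir t ω m) = sphereUniform (d m.succ)
  indep_dir : ∀ t m, Indep (MeasurableSpace.comap (fun ω => dir t ω m) inferInstance)
    (ℱ t ⊔ MeasurableSpace.comap (act t) ⊤ ⊔ MeasurableSpace.comap (sample t) ⊤) P
  /-- The first-order step of the server. -/
  server_step : ∀ t ω, w (t + 1) ω 0 = w t ω 0 - η • partialGrad (V.sampleLoss (sample t ω)) 0
    (delayedParams (fun s => w s ω) t (delay t ω (sample t ω)))
  /-- The zeroth-order step of the activated client; the other clients do not move. -/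
  client_step : ∀ t ω (m : Fin M), w (t + 1) ω m.succ =
    if act t ω = m then
      w t ω m.succ - η • zoEstimator (V.sampleLoss (sample t ω)) (μ m) m
        (delayedParams (fun s => w s ω) t (delay t ω (sample t ω))) (dir t ω m)
    else w t ω m.succ

end VFL

end

open VFL

/-!
The proof is the descent argument for smooth functions, with `K` the common Lipschitz constant of
all sample gradients. In one round the objective changes at most by the sum over the parties of
`⟪∇_{w_m} f, Δ_m⟫ + K / 2 * ‖Δ_m‖ ^ 2`, where `Δ_m` is the move of party `m`.

For a client, the two-point estimator in a unit direction `u` is `d ⟪x, u⟫ u` up to an error of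
order `d μ K` (`norm_zoEstimator_sub_le`), `x` being the partial gradient of the sampled loss at the
delayed parameters. As `u` is independent of everything else and its second moments are `I / d`
(`integral_coord_mul_coord_sphereUniform`), both terms reduce in mean to the exact partial gradient,
the quadratic one with a factor `d` and not `d ^ 2`: this is where `η K d ≤ 1 / 4` is needed. The
server uses its exact partial gradient, so its dimension never enters.

It remains to treat `-⟪g, x⟫ + c ‖x‖ ^ 2` with `g = ∇_{w_m} f` and `c ≤ 1 / 4`. Because the delays
depend on the sample, `x` is not an unbiased estimate of anything. Writing `x = g + ζ + e` with `ζ`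
the sampling noise at the current parameters and `e` the effect of the delay, expanding the square
leaves `ζ` linear only in `⟪g, ζ⟫` (`neg_inner_add_mul_norm_sq_le`), whose mean over the sample
vanishes, while `‖e‖` is bounded by `K` times the distance to the delayed parameters. That distance
is at most `staleness`, a sum of recent client moves that does not depend on the sample, on the
activated client or on the delays of the round; its mean is of order `τ ^ 2 η ^ 2`
since client gradients are bounded (`Run.integral_staleness_le`).

Integrability is carried along. The squared gradient is dominated by the gap `f - inf f`
(`norm_gradient_sq_le`), so an integrable objective value yields an integrable bound on the next
value (`Run.integral_objective_succ_le`). Summing over the rounds telescopes.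
-/

namespace VFL

/-! ### The uniform distribution on the sphere -/

section Sphere

open scoped Pointwise RealInnerProductSpace

variable {k : ℕ}

theorem sphereUniform_apply {s : Set (EuclideanSpace ℝ (Fin k))} (hs : MeasurableSet s) :
    sphereUniform k s =
      ((volume : Measure (EuclideanSpace ℝ (Fin k))).toSphere Set.univ)⁻¹ *
        (Module.finrank ℝ (EuclideanSpace ℝ (Fin k)) *
          volume (Set.Ioo (0 : ℝ) 1 • (Metric.sphere 0 1 ∩ s))) := by
  rw [sphereUniform, Measure.smul_apply, Measure.map_apply measurable_subtype_coe hs,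
    Measure.toSphere_apply' _ (measurable_subtype_coe hs), smul_eq_mul,
    Subtype.image_preimage_coe]

theorem isProbabilityMeasure_sphereUniform (hk : 0 < k) :
    IsProbabilityMeasure (sphereUniform k) := by
  have : Nonempty (Fin k) := ⟨⟨0, hk⟩⟩
  refine ⟨?_⟩
  rw [sphereUniform, Measure.smul_apply, Measure.map_apply measurable_subtype_coe .univ,
    Set.preimage_univ, smul_eq_mul]
  refine ENNReal.inv_mul_cancel ?_ (measure_ne_top _ _)
  rw [Ne, Measure.measure_univ_eq_zero]
  exact Measure.toSphere_ne_zero _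

theorem norm_eq_one_ae_sphereUniform : ∀ᵐ u ∂sphereUniform k, ‖u‖ = 1 := by
  have hs : MeasurableSet {u : EuclideanSpace ℝ (Fin k) | ‖u‖ = 1} :=
    measurableSet_eq_fun measurable_norm measurable_const
  refine Measure.ae_smul_measure ?_ _
  rw [ae_map_iff measurable_subtype_coe.aemeasurable hs]
  exact Filter.Eventually.of_forall fun x => by simp

theorem measurePreserving_sphereUniform
    (A : EuclideanSpace ℝ (Fin k) ≃ₗᵢ[ℝ] EuclideanSpace ℝ (Fin k)) :
    MeasurePreserving A (sphereUniform k) (sphereUniform k) := by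
  refine ⟨A.continuous.measurable, Measure.ext fun s hs => ?_⟩
  rw [Measure.map_apply A.continuous.measurable hs, sphereUniform_apply hs,
    sphereUniform_apply (A.continuous.measurable hs)]
  congr 2
  have hset : Set.Ioo (0 : ℝ) 1 • (Metric.sphere 0 1 ∩ A ⁻¹' s) =
      A ⁻¹' (Set.Ioo (0 : ℝ) 1 • (Metric.sphere 0 1 ∩ s)) := by
    ext x
    simp only [Set.mem_smul, Set.mem_preimage, Set.mem_inter_iff, mem_sphere_zero_iff_norm]
    constructor
    · rintro ⟨r, hr, y, ⟨hy, hys⟩, rfl⟩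
      exact ⟨r, hr, A y, ⟨by rw [A.norm_map, hy], hys⟩, by rw [map_smul]⟩
    · rintro ⟨r, hr, y, ⟨hy, hys⟩, hxy⟩
      refine ⟨r, hr, A.symm y, ⟨by rw [A.symm.norm_map, hy], by simpa using hys⟩, ?_⟩
      rw [← map_smul, hxy, A.symm_apply_apply]
  rw [hset]
  exact (A.measurePreserving).measure_preimage_equiv (f := A.toMeasurableEquiv) _

/-- The second moments of the uniform distribution on the sphere of `ℝ^k` are those of `I / k`:
sign changes of a coordinate kill the mixed moments, and coordinate swaps equate the others. -/
theorem integral_coord_mul_coord_sphereUniform (hk : 0 < k) (a b : Fin k) :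
    ∫ u, u a * u b ∂sphereUniform k = if a = b then 1 / (k : ℝ) else 0 := by
  have := isProbabilityMeasure_sphereUniform hk
  split_ifs with hab
  · subst hab
    have hswap : ∀ b : Fin k, ∫ u, u b * u b ∂sphereUniform k =
        ∫ u, u a * u a ∂sphereUniform k := by
      intro b
      let A : EuclideanSpace ℝ (Fin k) ≃ₗᵢ[ℝ] EuclideanSpace ℝ (Fin k) :=
        LinearIsometryEquiv.piLpCongrLeft 2 ℝ ℝ (Equiv.swap a b)
      have h := (measurePreserving_sphereUniform A).integral_comp
        A.toHomeomorph.measurableEmbedding (fun u => u a * u a)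
      rw [← h]
      refine integral_congr_ae (Filter.Eventually.of_forall fun u => ?_)
      simp [A, LinearIsometryEquiv.piLpCongrLeft_apply]
    have hint : ∀ b : Fin k, Integrable (fun u : EuclideanSpace ℝ (Fin k) => u b * u b)
        (sphereUniform k) := by
      intro b
      refine Integrable.of_bound (by fun_prop) 1 ?_
      filter_upwards [norm_eq_one_ae_sphereUniform] with u hu
      have := PiLp.norm_apply_le u b
      rw [norm_mul]
      rw [hu] at this
      exact mul_le_one₀ this (norm_nonneg _) this
    have hsum : ∑ b : Fin k, ∫ u, u b * u b ∂sphereUniform k = 1 := by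
      rw [← integral_finsetSum _ fun b _ => hint b]
      have : ∀ᵐ u ∂sphereUniform k, ∑ b : Fin k, u b * u b = 1 := by
        filter_upwards [norm_eq_one_ae_sphereUniform] with u hu
        have h := EuclideanSpace.real_norm_sq_eq u
        rw [hu] at h
        simp only [← sq]
        linarith
      rw [integral_congr_ae this]
      simp
    rw [Finset.sum_congr rfl fun b _ => hswap b] at hsum
    simp only [Finset.sum_const, Finset.card_univ, Fintype.card_fin, nsmul_eq_mul] at hsum
    have : (k : ℝ) ≠ 0 := by positivity
    rw [eq_div_iff this]
    linarith
  · let A : EuclideanSpace ℝ (Fin k) ≃ₗᵢ[ℝ] EuclideanSpace ℝ (Fin k) :=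
      LinearIsometryEquiv.piLpCongrRight 2 fun i =>
        if i = a then LinearIsometryEquiv.neg ℝ else LinearIsometryEquiv.refl ℝ ℝ
    have h := (measurePreserving_sphereUniform A).integral_comp
      A.toHomeomorph.measurableEmbedding (fun u => u a * u b)
    have hA : ∀ u, (A u) a * (A u) b = - (u a * u b) := by
      intro u
      simp [A, Ne.symm hab]
    simp only [hA, integral_neg] at h
    linarith

end Sphere

/-! ### Functions with Lipschitz gradient -/

section Smooth

open scoped RealInnerProductSpace

variable {E : Type*} [NormedAddCommGroup E] [InnerProductSpace ℝ E] [CompleteSpace E]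

theorem le_taylor_of_lipschitz_gradient {f : E → ℝ} {K : ℝ} (hf : Differentiable ℝ f)
    (hK : ∀ x y, ‖gradient f x - gradient f y‖ ≤ K * ‖x - y‖) (x h : E) :
    f (x + h) ≤ f x + ⟪gradient f x, h⟫ + K / 2 * ‖h‖ ^ 2 := by
  let φ : ℝ → ℝ := fun s => f (x + s • h) - s * ⟪gradient f x, h⟫ - K / 2 * ‖h‖ ^ 2 * s ^ 2
  have hφ : ∀ s, HasDerivAt φ (⟪gradient f (x + s • h), h⟫ - ⟪gradient f x, h⟫
      - K * ‖h‖ ^ 2 * s) s := by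
    intro s
    have h1 : HasDerivAt (fun s : ℝ => x + s • h) h s := by
      simpa using ((hasDerivAt_id s).smul_const h).const_add x
    have h2 : HasDerivAt (fun s : ℝ => f (x + s • h)) ⟪gradient f (x + s • h), h⟫ s := by
      rw [inner_gradient_left]
      exact (hf (x + s • h)).hasFDerivAt.comp_hasDerivAt s h1
    have h3 := (h2.sub ((hasDerivAt_id s).mul_const ⟪gradient f x, h⟫)).sub
      ((hasDerivAt_pow 2 s).const_mul (K / 2 * ‖h‖ ^ 2))
    refine h3.congr_deriv ?_
    simp
    ring
  have hanti : AntitoneOn φ (Set.Icc 0 1) := by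
    refine antitoneOn_of_deriv_nonpos (convex_Icc 0 1)
      (fun s _ => (hφ s).continuousAt.continuousWithinAt)
      (fun s _ => (hφ s).differentiableAt.differentiableWithinAt) fun s hs => ?_
    rw [interior_Icc] at hs
    rw [(hφ s).deriv, ← inner_sub_left]
    have h1 := real_inner_le_norm (gradient f (x + s • h) - gradient f x) h
    have h2 := hK (x + s • h) x
    rw [add_sub_cancel_left, norm_smul, Real.norm_of_nonneg hs.1.le] at h2
    have h3 := mul_le_mul_of_nonneg_right h2 (norm_nonneg h)
    nlinarith
  have := hanti (Set.left_mem_Icc.2 zero_le_one) (Set.right_mem_Icc.2 zero_le_one) zero_le_one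
  simp only [φ, one_smul, zero_smul, add_zero] at this
  linarith

theorem gradient_neg' (f : E → ℝ) (x : E) : gradient (fun y => - f y) x = - gradient f x := by
  simp [gradient, fderiv_fun_neg]

theorem abs_sub_taylor_le_of_lipschitz_gradient {f : E → ℝ} {K : ℝ} (hf : Differentiable ℝ f)
    (hK : ∀ x y, ‖gradient f x - gradient f y‖ ≤ K * ‖x - y‖) (x h : E) :
    |f (x + h) - f x - ⟪gradient f x, h⟫| ≤ K / 2 * ‖h‖ ^ 2 := by
  have h1 := le_taylor_of_lipschitz_gradient hf hK x h
  have h2 := le_taylor_of_lipschitz_gradient (f := fun y => - f y) hf.neg (K := K)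
    (fun x y => by
      rw [gradient_neg', gradient_neg', ← neg_sub', norm_neg]
      exact hK x y) x h
  rw [gradient_neg', inner_neg_left] at h2
  rw [abs_le]
  constructor <;> linarith

/-- A function bounded below with Lipschitz gradient has a small gradient where its value is
small, as one gradient step of length `1 / K` cannot get below the bound. -/
theorem norm_gradient_sq_le {f : E → ℝ} {K c : ℝ} (hKpos : 0 < K) (hf : Differentiable ℝ f)
    (hK : ∀ x y, ‖gradient f x - gradient f y‖ ≤ K * ‖x - y‖) (hc : ∀ x, c ≤ f x) (x : E) :
    ‖gradient f x‖ ^ 2 ≤ 2 * K * (f x - c) := by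
  have h1 := le_taylor_of_lipschitz_gradient hf hK x (-(1 / K) • gradient f x)
  have h2 := hc (x + -(1 / K) • gradient f x)
  rw [inner_smul_right, real_inner_self_eq_norm_sq, norm_smul, mul_pow, Real.norm_eq_abs,
    sq_abs] at h1
  have h3 : K / 2 * ((-(1 / K)) ^ 2 * ‖gradient f x‖ ^ 2) = 1 / (2 * K) * ‖gradient f x‖ ^ 2 := by
    field_simp
  have h4 : -(1 / K) * ‖gradient f x‖ ^ 2 = -(2 * (1 / (2 * K) * ‖gradient f x‖ ^ 2)) := by
    field_simp
  have h5 : 1 / (2 * K) * ‖gradient f x‖ ^ 2 ≤ f x - c := by linarith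
  rw [one_div, inv_mul_le_iff₀ (by positivity)] at h5
  exact h5

end Smooth

/-! ### One step of each party -/

section Step

open scoped RealInnerProductSpace

variable {E : Type*} [NormedAddCommGroup E] [InnerProductSpace ℝ E]

/-- Progress of a step along `x = g + ζ + e`, where `g` is the true gradient, `ζ` the sampling
noise and `e` the error caused by stale parameters. The noise enters linearly only through
`⟪g, ζ⟫`, which has mean zero, so the splitting stays valid although `e` depends on the sample. -/
theorem neg_inner_add_mul_norm_sq_le {c : ℝ} (hc : 0 ≤ c) (hc' : c ≤ 1 / 4) (g ζ e : E) :
    -⟪g, g + ζ + e⟫ + c * ‖g + ζ + e‖ ^ 2 ≤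
      -(1 / 2) * ‖g‖ ^ 2 + 3 / 4 * ‖e‖ ^ 2 + 2 * c * ‖ζ‖ ^ 2 - (1 - 2 * c) * ⟪g, ζ⟫ := by
  have h1 : ‖g + ζ + e‖ ^ 2 = ‖g‖ ^ 2 + ‖ζ‖ ^ 2 + ‖e‖ ^ 2 + 2 * ⟪g, ζ⟫ + 2 * ⟪g, e⟫
      + 2 * ⟪ζ, e⟫ := by
    rw [norm_add_sq_real, norm_add_sq_real, inner_add_left]
    ring
  have h2 : ‖ζ - e‖ ^ 2 = ‖ζ‖ ^ 2 - 2 * ⟪ζ, e⟫ + ‖e‖ ^ 2 := norm_sub_sq_real ζ e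
  have h3 : ‖g + e‖ ^ 2 = ‖g‖ ^ 2 + 2 * ⟪g, e⟫ + ‖e‖ ^ 2 := norm_add_sq_real g e
  have h4 : ⟪g, g + ζ + e⟫ = ‖g‖ ^ 2 + ⟪g, ζ⟫ + ⟪g, e⟫ := by
    rw [inner_add_right, inner_add_right, real_inner_self_eq_norm_sq]
  rw [h4, h1]
  nlinarith [mul_nonneg hc (sq_nonneg ‖ζ - e‖),
    mul_nonneg (by linarith : (0 : ℝ) ≤ (1 - 2 * c) / 2) (sq_nonneg ‖g + e‖),
    mul_nonneg (by linarith : (0 : ℝ) ≤ 1 / 4 - c) (sq_nonneg ‖e‖)]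

theorem norm_add_sq_le_two_mul (x y : E) : ‖x + y‖ ^ 2 ≤ 2 * ‖x‖ ^ 2 + 2 * ‖y‖ ^ 2 := by
  have h1 := norm_add_sq_real x y
  have h2 := norm_sub_sq_real x y
  nlinarith [sq_nonneg ‖x - y‖]

/-- An estimator within `R` of `(D ⟪x, u⟫) u` for a unit vector `u`, with the effect of the error
separated from the two quantities whose means over `u` are known. -/
theorem neg_inner_add_norm_sq_le_of_norm_sub_le {η K D R : ℝ} (hη : 0 ≤ η) (hK : 0 ≤ K)
    {g x u z : E} (hu : ‖u‖ = 1) (hz : ‖z - (D * ⟪x, u⟫) • u‖ ≤ R) :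
    -η * ⟪g, z⟫ + K / 2 * (η ^ 2 * ‖z‖ ^ 2) ≤
      -η * (D * (⟪x, u⟫ * ⟪g, u⟫)) + K * η ^ 2 * D * (D * (⟪x, u⟫ * ⟪x, u⟫))
        + η * (‖g‖ ^ 2 / 4 + R ^ 2) + K * η ^ 2 * R ^ 2 := by
  obtain ⟨r, hr⟩ : ∃ r, r = z - (D * ⟪x, u⟫) • u := ⟨_, rfl⟩
  have hzr : z = (D * ⟪x, u⟫) • u + r := by rw [hr]; abel
  rw [← hr] at hz
  have hrR : ‖r‖ ^ 2 ≤ R ^ 2 := pow_le_pow_left₀ (norm_nonneg _) hz 2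
  have h1 := norm_add_sq_le_two_mul ((D * ⟪x, u⟫) • u) r
  rw [← hzr, norm_smul, hu, mul_one, Real.norm_eq_abs, sq_abs] at h1
  have h2 : ⟪g, z⟫ = D * (⟪x, u⟫ * ⟪g, u⟫) + ⟪g, r⟫ := by
    rw [hzr, inner_add_right, inner_smul_right]
    ring
  have h3 : -⟪g, r⟫ ≤ ‖g‖ ^ 2 / 4 + R ^ 2 := by
    have := norm_add_sq_real ((1 / 2 : ℝ) • g) r
    rw [norm_smul, inner_smul_left, mul_pow] at this
    norm_num at this
    nlinarith [sq_nonneg ‖(1 / 2 : ℝ) • g + r‖]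
  rw [h2]
  have h4 : K / 2 * (η ^ 2 * ‖z‖ ^ 2) ≤
      K / 2 * (η ^ 2 * (2 * (D * ⟪x, u⟫) ^ 2 + 2 * R ^ 2)) := by
    gcongr
    linarith
  nlinarith [mul_le_mul_of_nonneg_left h3 hη]

theorem norm_sq_le_of_norm_sub_le {D R : ℝ} {x u z : E} (hu : ‖u‖ = 1)
    (hz : ‖z - (D * ⟪x, u⟫) • u‖ ≤ R) :
    ‖z‖ ^ 2 ≤ 2 * D * (D * (⟪x, u⟫ * ⟪x, u⟫)) + 2 * R ^ 2 := by
  have hrR := pow_le_pow_left₀ (norm_nonneg _) hz 2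
  have h1 := norm_add_sq_le_two_mul ((D * ⟪x, u⟫) • u) (z - (D * ⟪x, u⟫) • u)
  rw [add_sub_cancel, norm_smul, hu, mul_one, Real.norm_eq_abs, sq_abs] at h1
  nlinarith

end Step

/-! ### Blocks of the joint parameter space -/

section Blocks

open scoped RealInnerProductSpace

variable {M : ℕ} {d : Fin (M + 1) → ℕ}

theorem norm_block_le (v : Params d) (m : Fin (M + 1)) : ‖v m‖ ≤ ‖v‖ :=
  PiLp.norm_apply_le v m

theorem norm_partialGrad_sub_le {f : Params d → ℝ} {K : ℝ}
    (hK : ∀ x y, ‖gradient f x - gradient f y‖ ≤ K * ‖x - y‖) (m : Fin (M + 1)) (x y : Params d) :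
    ‖partialGrad f m x - partialGrad f m y‖ ≤ K * ‖x - y‖ :=
  (norm_block_le (gradient f x - gradient f y) m).trans (hK x y)

/-- The two-point estimator in a unit direction `u` is `d ⟪∇_{w_m} f, u⟫ u` up to an error of
order `μ`. -/
theorem norm_zoEstimator_sub_le {f : Params d → ℝ} {K μ : ℝ} (hf : Differentiable ℝ f)
    (hK : ∀ x y, ‖gradient f x - gradient f y‖ ≤ K * ‖x - y‖) (hμ : 0 < μ) (m : Fin M)
    (v : Params d) {u : EuclideanSpace ℝ (Fin (d m.succ))} (hu : ‖u‖ = 1) :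
    ‖zoEstimator f μ m v u - ((d m.succ : ℝ) * ⟪partialGrad f m.succ v, u⟫) • u‖
      ≤ d m.succ * μ * K / 2 := by
  have h1 := abs_sub_taylor_le_of_lipschitz_gradient hf hK v (PiLp.single 2 m.succ (μ • u))
  have h2 : ⟪gradient f v, PiLp.single 2 m.succ (μ • u)⟫ = μ * ⟪partialGrad f m.succ v, u⟫ := by
    rw [PiLp.inner_apply, Finset.sum_eq_single m.succ]
    · simp [partialGrad, inner_smul_right]
    · intro b _ hb
      simp [hb]
    · simp
  rw [h2, PiLp.norm_single, norm_smul, hu, mul_one, Real.norm_of_nonneg hμ.le] at h1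
  rw [zoEstimator, ← sub_smul, norm_smul, hu, mul_one, Real.norm_eq_abs]
  have h3 : (d m.succ : ℝ) / μ * (f (v + PiLp.single 2 m.succ (μ • u)) - f v)
      - d m.succ * ⟪partialGrad f m.succ v, u⟫ = d m.succ / μ *
        (f (v + PiLp.single 2 m.succ (μ • u)) - f v - μ * ⟪partialGrad f m.succ v, u⟫) := by
    field_simp
  rw [h3, abs_mul, abs_of_nonneg (by positivity)]
  calc (d m.succ : ℝ) / μ * |_| ≤ d m.succ / μ * (K / 2 * μ ^ 2) := by gcongr
    _ = d m.succ * μ * K / 2 := by field_simp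

theorem le_add_sum_blocks_of_lipschitz_gradient {f : Params d → ℝ} {K : ℝ}
    (hf : Differentiable ℝ f) (hK : ∀ x y, ‖gradient f x - gradient f y‖ ≤ K * ‖x - y‖)
    (v v' : Params d) :
    f v' ≤ f v + ∑ m, (⟪partialGrad f m v, v' m - v m⟫ + K / 2 * ‖v' m - v m‖ ^ 2) := by
  have h := le_taylor_of_lipschitz_gradient hf hK v (v' - v)
  rw [add_sub_cancel, PiLp.inner_apply, PiLp.norm_sq_eq_of_L2, Finset.mul_sum, add_assoc,
    ← Finset.sum_add_distrib] at h
  exact h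

theorem norm_gradient_sq_eq_sum (f : Params d → ℝ) (v : Params d) :
    ‖gradient f v‖ ^ 2 = ∑ m, ‖partialGrad f m v‖ ^ 2 :=
  PiLp.norm_sq_eq_of_L2 _ _

/-- How far the clients move in round `s`, squared. -/
noncomputable def clientDrift (w : ℕ → Params d) (s : ℕ) : ℝ :=
  ∑ m : Fin M, ‖w (s + 1) m.succ - w s m.succ‖ ^ 2

/-- A bound on the squared distance of the delayed parameters from the current ones, which does
not depend on the delays themselves but only on their bound `τ`. -/
noncomputable def staleness (w : ℕ → Params d) (τ t : ℕ) : ℝ :=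
  τ * ∑ s ∈ Finset.Ico (t - τ) t, clientDrift w s

theorem clientDrift_nonneg (w : ℕ → Params d) (s : ℕ) : 0 ≤ clientDrift w s := by
  unfold clientDrift; positivity

theorem staleness_nonneg (w : ℕ → Params d) (τ t : ℕ) : 0 ≤ staleness w τ t :=
  mul_nonneg (Nat.cast_nonneg _) (Finset.sum_nonneg fun _ _ => clientDrift_nonneg _ _)

theorem norm_sub_sq_le_sum_Ico {E : Type*} [NormedAddCommGroup E] (x : ℕ → E) {t δ τ : ℕ}
    (hδ : δ ≤ τ) :
    ‖x (t - δ) - x t‖ ^ 2 ≤ τ * ∑ s ∈ Finset.Ico (t - τ) t, ‖x (s + 1) - x s‖ ^ 2 := by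
  have h1 : ‖x (t - δ) - x t‖ ≤ ∑ s ∈ Finset.Ico (t - δ) t, ‖x (s + 1) - x s‖ := by
    rw [norm_sub_rev, ← Finset.sum_Ico_sub x (Nat.sub_le t δ)]
    exact norm_sum_le _ _
  have hcard : ((Finset.Ico (t - δ) t).card : ℝ) ≤ τ := by
    rw [Nat.card_Ico]
    exact_mod_cast (by omega : t - (t - δ) ≤ τ)
  calc ‖x (t - δ) - x t‖ ^ 2 ≤ (∑ s ∈ Finset.Ico (t - δ) t, ‖x (s + 1) - x s‖) ^ 2 := by gcongr
    _ ≤ (Finset.Ico (t - δ) t).card * ∑ s ∈ Finset.Ico (t - δ) t, ‖x (s + 1) - x s‖ ^ 2 :=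
      sq_sum_le_card_mul_sum_sq
    _ ≤ τ * ∑ s ∈ Finset.Ico (t - τ) t, ‖x (s + 1) - x s‖ ^ 2 := by
      gcongr

theorem norm_delayedParams_sub_sq_le (w : ℕ → Params d) (t : ℕ) {δ : Fin M → ℕ} {τ : ℕ}
    (hδ : ∀ m, δ m ≤ τ) : ‖delayedParams w t δ - w t‖ ^ 2 ≤ staleness w τ t := by
  rw [PiLp.norm_sq_eq_of_L2, Fin.sum_univ_succ]
  have h0 : (delayedParams w t δ - w t) 0 = 0 := by simp [delayedParams]
  rw [h0, norm_zero, zero_pow two_ne_zero, zero_add, staleness]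
  simp only [clientDrift]
  rw [Finset.sum_comm, Finset.mul_sum]
  refine Finset.sum_le_sum fun m _ => ?_
  have h1 : (delayedParams w t δ - w t) m.succ = w (t - δ m) m.succ - w t m.succ := by
    simp [delayedParams]
  rw [h1]
  exact norm_sub_sq_le_sum_Ico (fun s => w s m.succ) (hδ m)

end Blocks

/-! ### The objective -/

section Objective

variable {M n : ℕ} {d : Fin (M + 1) → ℕ} {X C : Fin M → Type*} {Z Y : Type*}
  (V : Problem n d X C Z Y)

theorem differentiable_objective (hdiff : ∀ i, Differentiable ℝ (V.sampleLoss i)) :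
    Differentiable ℝ V.objective := by
  unfold Problem.objective
  fun_prop

theorem gradient_objective (hdiff : ∀ i, Differentiable ℝ (V.sampleLoss i)) (v : Params d) :
    gradient V.objective v = (1 / (n : ℝ)) • ∑ i, gradient (V.sampleLoss i) v := by
  have h : HasFDerivAt V.objective ((1 / (n : ℝ)) • ∑ i, fderiv ℝ (V.sampleLoss i) v) v :=
    (HasFDerivAt.fun_sum fun i _ => (hdiff i v).hasFDerivAt).const_mul _
  rw [gradient, h.fderiv, map_smulₛₗ, map_sum]
  rfl

theorem norm_gradient_objective_sub_le {K : ℝ} (hn : 0 < n)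
    (hdiff : ∀ i, Differentiable ℝ (V.sampleLoss i))
    (hL : ∀ i x y, ‖gradient (V.sampleLoss i) x - gradient (V.sampleLoss i) y‖ ≤ K * ‖x - y‖)
    (x y : Params d) :
    ‖gradient V.objective x - gradient V.objective y‖ ≤ K * ‖x - y‖ := by
  have hn' : (0 : ℝ) < n := Nat.cast_pos.2 hn
  rw [gradient_objective V hdiff, gradient_objective V hdiff, ← smul_sub,
    ← Finset.sum_sub_distrib, norm_smul, Real.norm_of_nonneg (by positivity), one_div,
    inv_mul_le_iff₀ hn']
  refine (norm_sum_le_of_le _ fun i _ => hL i x y).trans (le_of_eq ?_)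
  simp

end Objective

/-! ### Expectations under independence -/

section Probability

open scoped RealInnerProductSpace

variable {Ω : Type*}

theorem measurable_eval_countable {m : MeasurableSpace Ω} {β γ : Type*} [Countable β]
    [MeasurableSpace β] [MeasurableSingletonClass β] [MeasurableSpace γ] {F : β → Ω → γ}
    (hF : ∀ b, Measurable (F b)) {X : Ω → β} (hX : Measurable X) :
    Measurable fun ω => F (X ω) ω :=
  (measurable_from_prod_countable_right (f := fun z : β × Ω => F z.1 z.2) hF).comp
    (hX.prodMk measurable_id)

theorem measurable_indicator_one {m : MeasurableSpace Ω} {A : Set Ω} (hA : MeasurableSet A) :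
    Measurable (A.indicator (1 : Ω → ℝ)) :=
  measurable_one.indicator hA

theorem measurable_coord_mul_coord {m : MeasurableSpace Ω} {k : ℕ}
    {X Y : Ω → EuclideanSpace ℝ (Fin k)} (hX : Measurable X) (hY : Measurable Y) (i j : Fin k) :
    Measurable fun ω => X ω i * Y ω j := by
  fun_prop

theorem indepFun_of_indep {m₁ m₂ mΩ : MeasurableSpace Ω} {P : Measure Ω}
    {β γ : Type*} [MeasurableSpace β] [MeasurableSpace γ] (h : Indep m₁ m₂ P) {f : Ω → β} {g : Ω → γ}
    (hf : Measurable[m₁] f)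
    (hg : Measurable[m₂] g) : IndepFun f g P :=
  (IndepFun_iff_Indep f g P).2
    (indep_of_indep_of_le_left (indep_of_indep_of_le_right h hg.comap_le) hf.comap_le)

/-- Integrability of `φ` is not needed if the event is null. -/
theorem integral_indicator_of_indep {m₁ m₂ mΩ : MeasurableSpace Ω} {P : Measure Ω}
    [IsFiniteMeasure P] (h₁ : m₁ ≤ mΩ) (h₂ : m₂ ≤ mΩ) (h : Indep m₁ m₂ P) {A : Set Ω}
    (hA : MeasurableSet[m₁] A)
    {φ : Ω → ℝ} (hφ : Measurable[m₂] φ) (hint : P.real A ≠ 0 → Integrable φ P) :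
    Integrable (A.indicator φ) P ∧ ∫ ω, A.indicator φ ω ∂P = P.real A * ∫ ω, φ ω ∂P := by
  have hA' : MeasurableSet A := h₁ A hA
  by_cases h0 : P.real A = 0
  · have hzero : A.indicator φ =ᵐ[P] 0 := by
      have hnull : ∀ᵐ ω ∂P, ω ∉ A := measure_eq_zero_iff_ae_notMem.1
        ((measureReal_eq_zero_iff (measure_ne_top _ _)).1 h0)
      filter_upwards [hnull] with ω hω
      simp [hω]
    refine ⟨(integrable_zero _ _ _).congr hzero.symm, ?_⟩
    rw [integral_congr_ae hzero, h0]
    simp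
  · refine ⟨(hint h0).indicator hA', ?_⟩
    have hind : IndepFun (A.indicator (1 : Ω → ℝ)) φ P :=
      indepFun_of_indep h (measurable_indicator_one hA) hφ
    have hmul : A.indicator φ = fun ω => A.indicator (1 : Ω → ℝ) ω * φ ω := by
      ext ω
      by_cases hω : ω ∈ A <;> simp [hω]
    rw [hmul, hind.integral_fun_mul_eq_mul_integral
      ((measurable_indicator_one hA').aestronglyMeasurable)
      ((hφ.mono h₂ le_rfl).aestronglyMeasurable), integral_indicator_one hA']

/-- The mean of `φ (X ω) ω` when the finitely valued `X` is independent of all `φ i`. -/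
theorem integral_eval_of_indep {m mΩ : MeasurableSpace Ω} {P : Measure Ω}
    [IsFiniteMeasure P] (hm : m ≤ mΩ)
    {n : ℕ} {X : Ω → Fin n} (hX : Measurable X) (h : Indep (MeasurableSpace.comap X ⊤) m P)
    {φ : Fin n → Ω → ℝ} (hφ : ∀ i, Measurable[m] (φ i))
    (hint : ∀ i, P.real {ω | X ω = i} ≠ 0 → Integrable (φ i) P) :
    Integrable (fun ω => φ (X ω) ω) P ∧
      ∫ ω, φ (X ω) ω ∂P = ∑ i, P.real {ω | X ω = i} * ∫ ω, φ i ω ∂P := by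
  have key := fun i => integral_indicator_of_indep (A := {ω | X ω = i})
    hX.comap_le hm h ⟨{i}, trivial, rfl⟩ (hφ i) (hint i)
  have hsum : (fun ω => φ (X ω) ω) = fun ω => ∑ i, {ω | X ω = i}.indicator (φ i) ω := by
    ext ω
    simp [Set.indicator_apply]
  rw [hsum, integral_finsetSum _ fun i _ => (key i).1]
  exact ⟨integrable_finsetSum _ fun i _ => (key i).1, Finset.sum_congr rfl fun i _ => (key i).2⟩

/-- `E[k ⟪X, u⟫ ⟪Y, u⟫] = E ⟪X, Y⟫` for `u` uniform on the unit sphere of `ℝ^k` and independent of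
the bounded vectors `X` and `Y`. -/
theorem integral_inner_mul_inner_of_indep {m mΩ : MeasurableSpace Ω} {P : Measure Ω}
    [IsProbabilityMeasure P] (hm : m ≤ mΩ) {k : ℕ} (hk : 0 < k) {u : Ω → EuclideanSpace ℝ (Fin k)}
    (hu : Measurable u)
    (hlaw : P.map u = sphereUniform k)
    (h : Indep (MeasurableSpace.comap u inferInstance) m P)
    {X Y : Ω → EuclideanSpace ℝ (Fin k)} (hX : Measurable[m] X) (hY : Measurable[m] Y)
    {a b : ℝ} (hXa : ∀ ω, ‖X ω‖ ≤ a) (hYb : ∀ ω, ‖Y ω‖ ≤ b) :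
    Integrable (fun ω => (k : ℝ) * (⟪X ω, u ω⟫ * ⟪Y ω, u ω⟫)) P ∧
      ∫ ω, (k : ℝ) * (⟪X ω, u ω⟫ * ⟪Y ω, u ω⟫) ∂P = ∫ ω, ⟪X ω, Y ω⟫ ∂P := by
  have hunit : ∀ᵐ ω ∂P, ‖u ω‖ = 1 := by
    have := norm_eq_one_ae_sphereUniform (k := k)
    rw [← hlaw] at this
    exact ae_of_ae_map hu.aemeasurable this
  have hXY : ∀ i j, Measurable[m] fun ω => X ω i * Y ω j := fun i j =>
    measurable_coord_mul_coord hX hY i j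
  have hXYint : ∀ i j, Integrable (fun ω => X ω i * Y ω j) P := fun i j => by
    refine Integrable.of_bound ((hXY i j).mono hm le_rfl).aestronglyMeasurable (a * b)
      (Filter.Eventually.of_forall fun ω => ?_)
    rw [norm_mul]
    exact mul_le_mul ((PiLp.norm_apply_le _ _).trans (hXa ω))
      ((PiLp.norm_apply_le _ _).trans (hYb ω)) (norm_nonneg _) ((norm_nonneg _).trans (hXa ω))
  have huu : ∀ i j, Integrable (fun ω => u ω i * u ω j) P := fun i j => by
    refine Integrable.of_bound
      (measurable_coord_mul_coord hu hu i j).aestronglyMeasurable 1 ?_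
    filter_upwards [hunit] with ω hω
    rw [norm_mul]
    have h1 := PiLp.norm_apply_le (u ω) i
    have h2 := PiLp.norm_apply_le (u ω) j
    rw [hω] at h1 h2
    exact mul_le_one₀ h1 (norm_nonneg _) h2
  have hind : ∀ i j, IndepFun (fun ω => u ω i * u ω j) (fun ω => X ω i * Y ω j) P := fun i j =>
    indepFun_of_indep h
      (measurable_coord_mul_coord (comap_measurable u) (comap_measurable u) i j)
      (hXY i j)
  have hmoment : ∀ i j, ∫ ω, u ω i * u ω j ∂P = if i = j then 1 / (k : ℝ) else 0 := fun i j => by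
    rw [← integral_coord_mul_coord_sphereUniform hk i j, ← hlaw, integral_map hu.aemeasurable]
    exact (measurable_coord_mul_coord measurable_id measurable_id i j).aestronglyMeasurable
  have hterm : ∀ i j, Integrable (fun ω => (u ω i * u ω j) * (X ω i * Y ω j)) P := fun i j =>
    (hind i j).integrable_mul (huu i j) (hXYint i j)
  have hexp : (fun ω => (k : ℝ) * (⟪X ω, u ω⟫ * ⟪Y ω, u ω⟫)) =
      fun ω => (k : ℝ) * ∑ i, ∑ j, (u ω i * u ω j) * (X ω i * Y ω j) := by
    ext ω
    rw [PiLp.inner_apply, PiLp.inner_apply, Finset.sum_mul_sum]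
    congr 1
    refine Finset.sum_congr rfl fun i _ => Finset.sum_congr rfl fun j _ => ?_
    simp
    ring
  rw [hexp]
  refine ⟨(integrable_finsetSum _ fun i _ => integrable_finsetSum _ fun j _ =>
    hterm i j).const_mul _, ?_⟩
  rw [integral_const_mul, integral_finsetSum _ fun i _ => integrable_finsetSum _ fun j _ =>
    hterm i j]
  have hk' : (k : ℝ) ≠ 0 := by positivity
  have hrow : ∀ i, ∫ ω, ∑ j, (u ω i * u ω j) * (X ω i * Y ω j) ∂P =
      1 / (k : ℝ) * ∫ ω, X ω i * Y ω i ∂P := fun i => by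
    rw [integral_finsetSum _ fun j _ => hterm i j]
    simp_rw [(hind i _).integral_fun_mul_eq_mul_integral (huu i _).aestronglyMeasurable
      (hXYint i _).aestronglyMeasurable, hmoment]
    simp
  simp_rw [hrow, ← Finset.mul_sum]
  rw [← integral_finsetSum _ fun i _ => hXYint i i, ← mul_assoc, mul_one_div_cancel hk', one_mul]
  refine integral_congr_ae (Filter.Eventually.of_forall fun ω => ?_)
  simp only [PiLp.inner_apply]
  refine Finset.sum_congr rfl fun i _ => ?_
  simp
  ring

end Probability

/-! ### Conditional progress of one round -/

section Round

open scoped RealInnerProductSpace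

variable {M n : ℕ} {d : Fin (M + 1) → ℕ} {X C : Fin M → Type*} {Z Y : Type*}

/-- The regularity of a problem that the analysis uses: smooth sample losses with one Lipschitz
constant `K` for their gradients, unbiased stochastic partial gradients of bounded variance under
the sampling law `q`, and bounded client gradients. -/
structure Regular (V : Problem n d X C Z Y) (q : Fin n → ℝ) (K : ℝ) (σ : Fin (M + 1) → ℝ)
    (G : Fin M → ℝ) : Prop where
  pos : 0 < K
  differentiable : ∀ i, Differentiable ℝ (V.sampleLoss i)
  lipschitz : ∀ i x y,
    ‖gradient (V.sampleLoss i) x - gradient (V.sampleLoss i) y‖ ≤ K * ‖x - y‖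
  unbiased : ∀ m v, ∑ i, q i • partialGrad (V.sampleLoss i) m v = partialGrad V.objective m v
  variance : ∀ m v,
    ∑ i, q i * ‖partialGrad (V.sampleLoss i) m v - partialGrad V.objective m v‖ ^ 2 ≤ σ m ^ 2
  bounded : ∀ (m : Fin M) i v, ‖partialGrad (V.sampleLoss i) m.succ v‖ ≤ G m
  law_nonneg : ∀ i, 0 ≤ q i
  law_sum : ∑ i, q i = 1

variable {V : Problem n d X C Z Y} {q : Fin n → ℝ} {K : ℝ} {σ : Fin (M + 1) → ℝ} {G : Fin M → ℝ}

theorem Regular.lipschitz_objective (hV : Regular V q K σ G) (x y : Params d) :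
    ‖gradient V.objective x - gradient V.objective y‖ ≤ K * ‖x - y‖ := by
  refine norm_gradient_objective_sub_le V ?_ hV.differentiable hV.lipschitz x y
  rcases Nat.eq_zero_or_pos n with rfl | h
  · simpa using hV.law_sum
  · exact h

theorem continuous_gradient_of_lipschitz {f : Params d → ℝ}
    (hK : ∀ x y, ‖gradient f x - gradient f y‖ ≤ K * ‖x - y‖) : Continuous (gradient f) :=
  (LipschitzWith.of_dist_le' (K := K) fun x y => by
    simpa only [dist_eq_norm] using hK x y).continuous

theorem continuous_partialGrad {f : Params d → ℝ} (h : Continuous (gradient f))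
    (m : Fin (M + 1)) : Continuous (partialGrad f m) := by
  unfold partialGrad
  fun_prop

theorem Regular.continuous_sample (hV : Regular V q K σ G) (i : Fin n) (m : Fin (M + 1)) :
    Continuous (partialGrad (V.sampleLoss i) m) :=
  continuous_partialGrad (continuous_gradient_of_lipschitz (hV.lipschitz i)) m

theorem Regular.continuous_objective (hV : Regular V q K σ G) (m : Fin (M + 1)) :
    Continuous (partialGrad V.objective m) :=
  continuous_partialGrad (continuous_gradient_of_lipschitz hV.lipschitz_objective) m

theorem Regular.norm_objective_le (hV : Regular V q K σ G) (m : Fin M) (v : Params d) :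
    ‖partialGrad V.objective m.succ v‖ ≤ G m := by
  rw [← hV.unbiased]
  refine (norm_sum_le_of_le (f := fun i => q i • partialGrad (V.sampleLoss i) m.succ v)
    (n := fun i => q i * G m) _ fun i _ => ?_).trans_eq ?_
  · rw [norm_smul, Real.norm_of_nonneg (hV.law_nonneg i)]
    exact mul_le_mul_of_nonneg_left (hV.bounded m i v) (hV.law_nonneg i)
  · rw [← Finset.sum_mul, hV.law_sum, one_mul]

/-- The sampling error `∇_{w_m} f_i - ∇_{w_m} f`. -/
noncomputable def samplingNoise (V : Problem n d X C Z Y) (m : Fin (M + 1)) (i : Fin n)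
    (v : Params d) : EuclideanSpace ℝ (Fin (d m)) :=
  partialGrad (V.sampleLoss i) m v - partialGrad V.objective m v

/-- The upper bound of `neg_inner_add_mul_norm_sq_le` for party `m` and sample `i`, with a bound
`S` on the squared staleness error. -/
noncomputable def progressBound (V : Problem n d X C Z Y) (m : Fin (M + 1)) (c : ℝ) (i : Fin n)
    (S : ℝ) (v : Params d) : ℝ :=
  -(1 / 2) * ‖partialGrad V.objective m v‖ ^ 2 + 3 / 4 * S + 2 * c * ‖samplingNoise V m i v‖ ^ 2
    - (1 - 2 * c) * ⟪partialGrad V.objective m v, samplingNoise V m i v⟫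

theorem Regular.neg_inner_add_le_progressBound (hV : Regular V q K σ G) {c S : ℝ} (hc : 0 ≤ c)
    (hc' : c ≤ 1 / 4) (m : Fin (M + 1)) (i : Fin n) {v v' : Params d} (hS : ‖v' - v‖ ^ 2 ≤ S) :
    -⟪partialGrad V.objective m v, partialGrad (V.sampleLoss i) m v'⟫
        + c * ‖partialGrad (V.sampleLoss i) m v'‖ ^ 2 ≤
      progressBound V m c i (K ^ 2 * S) v := by
  have h := neg_inner_add_mul_norm_sq_le hc hc' (partialGrad V.objective m v)
    (samplingNoise V m i v)
    (partialGrad (V.sampleLoss i) m v' - partialGrad (V.sampleLoss i) m v)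
  have hsum : partialGrad V.objective m v + samplingNoise V m i v
      + (partialGrad (V.sampleLoss i) m v' - partialGrad (V.sampleLoss i) m v)
        = partialGrad (V.sampleLoss i) m v' := by
    rw [samplingNoise]; abel
  rw [hsum] at h
  have he : ‖partialGrad (V.sampleLoss i) m v' - partialGrad (V.sampleLoss i) m v‖ ^ 2
      ≤ K ^ 2 * S := by
    calc _ ≤ (K * ‖v' - v‖) ^ 2 := by
          gcongr
          exact norm_partialGrad_sub_le (hV.lipschitz i) m v' v
      _ = K ^ 2 * ‖v' - v‖ ^ 2 := mul_pow _ _ _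
      _ ≤ K ^ 2 * S := by gcongr
  rw [progressBound]
  linarith

/-- The mean over the sample removes the linear term and bounds the noise by its variance. -/
theorem Regular.sum_progressBound_le (hV : Regular V q K σ G) {c : ℝ} (hc : 0 ≤ c)
    (m : Fin (M + 1)) (S : ℝ) (v : Params d) :
    ∑ i, q i * progressBound V m c i S v ≤
      -(1 / 2) * ‖partialGrad V.objective m v‖ ^ 2 + 3 / 4 * S + 2 * c * σ m ^ 2 := by
  have hmean : ∑ i, q i * ⟪partialGrad V.objective m v, samplingNoise V m i v⟫ = 0 := by
    have h : ∑ i, q i • samplingNoise V m i v = 0 := by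
      simp only [samplingNoise, smul_sub, Finset.sum_sub_distrib, hV.unbiased, ← Finset.sum_smul,
        hV.law_sum, one_smul, sub_self]
    rw [← inner_zero_right (𝕜 := ℝ) (partialGrad V.objective m v), ← h, inner_sum]
    simp only [inner_smul_right]
  have hvar : ∑ i, q i * ‖samplingNoise V m i v‖ ^ 2 ≤ σ m ^ 2 := hV.variance m v
  have hsplit : ∑ i, q i * progressBound V m c i S v =
      (∑ i, q i) * (-(1 / 2) * ‖partialGrad V.objective m v‖ ^ 2 + 3 / 4 * S)
      + 2 * c * ∑ i, q i * ‖samplingNoise V m i v‖ ^ 2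
      - (1 - 2 * c) * ∑ i, q i * ⟪partialGrad V.objective m v, samplingNoise V m i v⟫ := by
    rw [Finset.sum_mul, Finset.mul_sum, Finset.mul_sum, ← Finset.sum_add_distrib,
      ← Finset.sum_sub_distrib]
    refine Finset.sum_congr rfl fun i _ => ?_
    rw [progressBound]
    ring
  rw [hsplit, hmean, hV.law_sum]
  nlinarith [mul_le_mul_of_nonneg_left hvar (by linarith : 0 ≤ 2 * c)]

variable {Ω : Type*}

theorem Regular.measurable_samplingNoise (hV : Regular V q K σ G) {mΩ : MeasurableSpace Ω}
    {v : Ω → Params d} (hv : Measurable v) (m : Fin (M + 1)) (i : Fin n) :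
    Measurable fun ω => samplingNoise V m i (v ω) :=
  ((hV.continuous_sample i m).measurable.comp hv).sub
    ((hV.continuous_objective m).measurable.comp hv)

theorem Regular.measurable_progressBound (hV : Regular V q K σ G) {mΩ : MeasurableSpace Ω}
    {v : Ω → Params d} (hv : Measurable v) {S : Ω → ℝ} (hS : Measurable S) (m : Fin (M + 1))
    (c : ℝ) (i : Fin n) : Measurable fun ω => progressBound V m c i (S ω) (v ω) := by
  have h1 := hV.measurable_samplingNoise hv m i
  have h2 : Measurable fun ω => partialGrad V.objective m (v ω) :=
    (hV.continuous_objective m).measurable.comp hv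
  unfold progressBound
  exact (((h2.norm.pow_const 2).const_mul _).add (hS.const_mul _)).add
    ((h1.norm.pow_const 2).const_mul _) |>.sub ((h2.inner h1).const_mul _)

/-- Samples of weight zero are excluded: the variance bound says nothing about their gradients. -/
theorem Regular.integrable_progressBound (hV : Regular V q K σ G) {mΩ : MeasurableSpace Ω}
    {P : Measure Ω} [IsFiniteMeasure P] {v : Ω → Params d} (hv : Measurable v) {S : Ω → ℝ}
    (hS : Integrable S P) {m : Fin (M + 1)}
    (hg : Integrable (fun ω => ‖partialGrad V.objective m (v ω)‖ ^ 2) P)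
    (c : ℝ) {i : Fin n} (hi : q i ≠ 0) :
    Integrable (fun ω => progressBound V m c i (S ω) (v ω)) P := by
  have hqi : 0 < q i := (hV.law_nonneg i).lt_of_ne' hi
  have hnoise : Integrable (fun ω => ‖samplingNoise V m i (v ω)‖ ^ 2) P := by
    refine Integrable.of_bound
      ((hV.measurable_samplingNoise hv m i).norm.pow_const 2).aestronglyMeasurable
      (σ m ^ 2 / q i) (Filter.Eventually.of_forall fun ω => ?_)
    rw [Real.norm_of_nonneg (by positivity), le_div_iff₀' hqi]
    refine le_trans ?_ (hV.variance m (v ω))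
    exact Finset.single_le_sum
      (f := fun i => q i * ‖partialGrad (V.sampleLoss i) m (v ω) - partialGrad V.objective m (v ω)‖
        ^ 2) (fun j _ => mul_nonneg (hV.law_nonneg j) (sq_nonneg _)) (Finset.mem_univ i)
  have hinner : Integrable
      (fun ω => ⟪partialGrad V.objective m (v ω), samplingNoise V m i (v ω)⟫) P := by
    refine (hg.add hnoise).mono' (((hV.continuous_objective m).measurable.comp hv).inner
      (hV.measurable_samplingNoise hv m i)).aestronglyMeasurable
      (Filter.Eventually.of_forall fun ω => ?_)
    refine (norm_inner_le_norm _ _).trans ?_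
    simp only [Pi.add_apply]
    nlinarith [sq_nonneg (‖partialGrad V.objective m (v ω)‖ - ‖samplingNoise V m i (v ω)‖),
      sq_nonneg ‖partialGrad V.objective m (v ω)‖, sq_nonneg ‖samplingNoise V m i (v ω)‖]
  exact (((hg.const_mul _).add (hS.const_mul _)).add (hnoise.const_mul _)).sub
    (hinner.const_mul _)

theorem Regular.sum_integral_progressBound_le (hV : Regular V q K σ G) {mΩ : MeasurableSpace Ω}
    {P : Measure Ω} [IsProbabilityMeasure P] {v : Ω → Params d} (hv : Measurable v) {S : Ω → ℝ}
    (hS : Integrable S P) {m : Fin (M + 1)}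
    (hg : Integrable (fun ω => ‖partialGrad V.objective m (v ω)‖ ^ 2) P)
    {c : ℝ} (hc : 0 ≤ c) :
    ∑ i, q i * ∫ ω, progressBound V m c i (S ω) (v ω) ∂P ≤
      -(1 / 2) * ∫ ω, ‖partialGrad V.objective m (v ω)‖ ^ 2 ∂P + 3 / 4 * ∫ ω, S ω ∂P
        + 2 * c * σ m ^ 2 := by
  have hint : ∀ i, Integrable (fun ω => q i * progressBound V m c i (S ω) (v ω)) P := by
    intro i
    by_cases hi : q i = 0
    · simp [hi]
    · exact (hV.integrable_progressBound hv hS hg c hi).const_mul _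
  have h1 : Integrable
      (fun ω => -(1 / 2) * ‖partialGrad V.objective m (v ω)‖ ^ 2 + 3 / 4 * S ω) P :=
    (hg.const_mul _).add (hS.const_mul _)
  calc ∑ i, q i * ∫ ω, progressBound V m c i (S ω) (v ω) ∂P
      = ∫ ω, ∑ i, q i * progressBound V m c i (S ω) (v ω) ∂P := by
        rw [integral_finsetSum _ fun i _ => hint i]
        simp only [integral_const_mul]
    _ ≤ ∫ ω, (-(1 / 2) * ‖partialGrad V.objective m (v ω)‖ ^ 2 + 3 / 4 * S ω
          + 2 * c * σ m ^ 2) ∂P :=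
        integral_mono (integrable_finsetSum _ fun i _ => hint i)
          (h1.add (integrable_const _)) fun ω => hV.sum_progressBound_le hc m (S ω) (v ω)
    _ = _ := by
        rw [integral_add h1 (integrable_const _), integral_add (hg.const_mul _) (hS.const_mul _),
          integral_const_mul, integral_const_mul]
        simp

end Round

/-! ### Measurability along a run -/

section Run

open scoped RealInnerProductSpace

variable {M n : ℕ} {d : Fin (M + 1) → ℕ} {X C : Fin M → Type*} {Z Y : Type*}
  {V : Problem n d X C Z Y} {q : Fin n → ℝ} {K : ℝ} {σ : Fin (M + 1) → ℝ} {G : Fin M → ℝ}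
  {η : ℝ} {μ p : Fin M → ℝ} {Ω : Type*} {mΩ : MeasurableSpace Ω} {P : Measure Ω}
  {ℱ : Filtration ℕ mΩ} {act : ℕ → Ω → Fin M} {sample : ℕ → Ω → Fin n}
  {dir : ℕ → Ω → ∀ m : Fin M, EuclideanSpace ℝ (Fin (d m.succ))}
  {delay : ℕ → Ω → Fin n → Fin M → ℕ} {w : ℕ → Ω → Params d}

/-- The information in round `t` once the activated client is known. -/
abbrev beforeSample (ℱ : Filtration ℕ mΩ) (act : ℕ → Ω → Fin M) (t : ℕ) : MeasurableSpace Ω :=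
  ℱ t ⊔ MeasurableSpace.comap (act t) ⊤

/-- The information in round `t` once the activated client and the sample are known. -/
abbrev beforeDir (ℱ : Filtration ℕ mΩ) (act : ℕ → Ω → Fin M) (sample : ℕ → Ω → Fin n) (t : ℕ) :
    MeasurableSpace Ω :=
  ℱ t ⊔ MeasurableSpace.comap (act t) ⊤ ⊔ MeasurableSpace.comap (sample t) ⊤

/-- The delayed parameters that round `t` evaluates the sampled loss at. -/
noncomputable def usedParams (sample : ℕ → Ω → Fin n) (delay : ℕ → Ω → Fin n → Fin M → ℕ)
    (w : ℕ → Ω → Params d) (t : ℕ) (ω : Ω) : Params d :=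
  delayedParams (fun s => w s ω) t (delay t ω (sample t ω))

/-- The partial gradient at the used parameters that the step of client `m` estimates; it is zero
in the rounds in which `m` is not activated. -/
noncomputable def activeGrad (V : Problem n d X C Z Y) (act : ℕ → Ω → Fin M)
    (sample : ℕ → Ω → Fin n) (delay : ℕ → Ω → Fin n → Fin M → ℕ) (w : ℕ → Ω → Params d) (t : ℕ)
    (m : Fin M) : Ω → EuclideanSpace ℝ (Fin (d m.succ)) :=
  {ω | act t ω = m}.indicator fun ω =>
    partialGrad (V.sampleLoss (sample t ω)) m.succ (usedParams sample delay w t ω)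

theorem measurable_delayedParams {m : MeasurableSpace Ω} {w : ℕ → Ω → Params d} {t : ℕ}
    (hw : ∀ s ≤ t, Measurable (w s)) {δ : Ω → Fin M → ℕ} (hδ : ∀ j, Measurable fun ω => δ ω j) :
    Measurable fun ω => delayedParams (fun s => w s ω) t (δ ω) := by
  have hblock : ∀ s ≤ t, ∀ j, Measurable fun ω => w s ω j := fun s hs j => by
    have : Measurable fun v : Params d => v j := Continuous.measurable (by fun_prop)
    exact this.comp (hw s hs)
  refine (WithLp.measurable_toLp 2 _).comp (measurable_pi_iff.2 fun j => ?_)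
  refine Fin.cases ?_ (fun j => ?_) j
  · exact hblock t le_rfl 0
  · exact measurable_eval_countable (F := fun k ω => w (t - k) ω j.succ)
      (fun k => hblock _ (Nat.sub_le _ _) _) (hδ j)

theorem measurable_clientDrift {m : MeasurableSpace Ω} {w : ℕ → Ω → Params d} {s : ℕ}
    (h : Measurable (w s)) (h' : Measurable (w (s + 1))) :
    Measurable fun ω => clientDrift (fun s => w s ω) s := by
  have hblock : ∀ j, Measurable fun v : Params d => v j := fun j =>
    Continuous.measurable (by fun_prop)
  unfold clientDrift
  exact Finset.measurable_fun_sum _ fun j _ =>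
    ((((hblock j.succ).comp h').sub ((hblock j.succ).comp h)).norm.pow_const 2)

theorem measurable_staleness {m : MeasurableSpace Ω} {w : ℕ → Ω → Params d} {t : ℕ}
    (hw : ∀ s ≤ t, Measurable (w s)) (τ : ℕ) :
    Measurable fun ω => staleness (fun s => w s ω) τ t := by
  unfold staleness
  refine (Finset.measurable_fun_sum _ fun s hs => ?_).const_mul _
  have := (Finset.mem_Ico.1 hs).2
  exact measurable_clientDrift (hw s this.le) (hw (s + 1) this)

theorem Run.measurable_past (hrun : Run V η μ p q P ℱ act sample dir delay w) (t : ℕ) :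
    ∀ s ≤ t, Measurable[ℱ t] (w s) := fun s hs =>
  (hrun.adapted s).mono (ℱ.mono hs) le_rfl

theorem Run.measurable_params (hrun : Run V η μ p q P ℱ act sample dir delay w) (t : ℕ) :
    Measurable (w t) :=
  (hrun.adapted t).mono (ℱ.le t) le_rfl

theorem Run.measurable_act' (hrun : Run V η μ p q P ℱ act sample dir delay w) (t : ℕ) :
    Measurable (act t) :=
  (hrun.measurable_act t).mono (ℱ.le _) le_rfl

theorem Run.measurable_sample' (hrun : Run V η μ p q P ℱ act sample dir delay w) (t : ℕ) :
    Measurable (sample t) :=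
  (hrun.measurable_sample t).mono (ℱ.le _) le_rfl

theorem Run.measurable_dir' (hrun : Run V η μ p q P ℱ act sample dir delay w) (t : ℕ)
    (m : Fin M) : Measurable fun ω => dir t ω m :=
  (hrun.measurable_dir t m).mono (ℱ.le _) le_rfl

theorem Run.beforeSample_le (hrun : Run V η μ p q P ℱ act sample dir delay w) (t : ℕ) :
    beforeSample ℱ act t ≤ mΩ :=
  sup_le (ℱ.le t) (hrun.measurable_act' t).comap_le

theorem Run.beforeDir_le (hrun : Run V η μ p q P ℱ act sample dir delay w) (t : ℕ) :
    beforeDir ℱ act sample t ≤ mΩ :=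
  sup_le (hrun.beforeSample_le t) (hrun.measurable_sample' t).comap_le

theorem measurableSet_act_beforeSample (t : ℕ) (m : Fin M) :
    MeasurableSet[beforeSample ℱ act t] {ω | act t ω = m} :=
  (le_sup_right : MeasurableSpace.comap (act t) ⊤ ≤ beforeSample ℱ act t) _ ⟨{m}, trivial, rfl⟩

theorem Run.measurableSet_act (hrun : Run V η μ p q P ℱ act sample dir delay w) (t : ℕ)
    (m : Fin M) : MeasurableSet {ω | act t ω = m} :=
  hrun.beforeSample_le t _ (measurableSet_act_beforeSample t m)

theorem Run.measurable_usedParams (hrun : Run V η μ p q P ℱ act sample dir delay w) (t : ℕ) :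
    Measurable[beforeDir ℱ act sample t] (usedParams sample delay w t) := by
  have hle : ℱ t ≤ beforeDir ℱ act sample t := le_sup_left.trans le_sup_left
  refine measurable_eval_countable (m := beforeDir ℱ act sample t)
    (F := fun i ω => delayedParams (fun s => w s ω) t (delay t ω i)) (fun i => ?_)
    ((comap_measurable (sample t)).mono le_sup_right le_rfl)
  exact measurable_delayedParams (m := beforeDir ℱ act sample t)
    (fun s hs => (hrun.measurable_past t s hs).mono hle le_rfl)
    fun j => (hrun.measurable_delay t i j).mono le_sup_left le_rfl

theorem Run.measurable_activeGrad (hrun : Run V η μ p q P ℱ act sample dir delay w)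
    (hV : Regular V q K σ G) (t : ℕ) (m : Fin M) :
    Measurable[beforeDir ℱ act sample t] (activeGrad V act sample delay w t m) := by
  have h : Measurable[beforeDir ℱ act sample t] fun ω =>
      partialGrad (V.sampleLoss (sample t ω)) m.succ (usedParams sample delay w t ω) :=
    measurable_eval_countable (m := beforeDir ℱ act sample t)
      (F := fun i ω => partialGrad (V.sampleLoss i) m.succ (usedParams sample delay w t ω))
      (fun i => (hV.continuous_sample i m.succ).measurable.comp (hrun.measurable_usedParams t))
      ((comap_measurable (sample t)).mono le_sup_right le_rfl)
  have hA : MeasurableSet[beforeDir ℱ act sample t] {ω | act t ω = m} :=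
    (le_sup_left : beforeSample ℱ act t ≤ beforeDir ℱ act sample t) _
      (measurableSet_act_beforeSample t m)
  exact Measurable.indicator (m := beforeDir ℱ act sample t) h hA

theorem Regular.norm_activeGrad_le (hV : Regular V q K σ G) (t : ℕ) (m : Fin M) (ω : Ω) :
    ‖activeGrad V act sample delay w t m ω‖ ≤ G m :=
  (norm_indicator_le_norm_self _ _).trans (hV.bounded m _ _)

theorem Run.ae_norm_dir (hrun : Run V η μ p q P ℱ act sample dir delay w) (t : ℕ) (m : Fin M) :
    ∀ᵐ ω ∂P, ‖dir t ω m‖ = 1 := by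
  have := norm_eq_one_ae_sphereUniform (k := d m.succ)
  rw [← hrun.law_dir t m] at this
  exact ae_of_ae_map (hrun.measurable_dir' t m).aemeasurable this

theorem Run.sum_law_act [IsProbabilityMeasure P]
    (hrun : Run V η μ p q P ℱ act sample dir delay w) : ∑ m, p m = 1 := by
  have h := (integral_eval_of_indep (φ := fun _ _ => 1) (ℱ.le 0) (hrun.measurable_act' 0)
    (hrun.indep_act 0) (fun _ => measurable_const) fun _ _ => integrable_const _).2
  simpa [hrun.law_act] using h.symm

theorem Run.sum_law_sample [IsProbabilityMeasure P]
    (hrun : Run V η μ p q P ℱ act sample dir delay w) : ∑ i, q i = 1 := by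
  have h := (integral_eval_of_indep (φ := fun _ _ => 1) (hrun.beforeSample_le 0)
    (hrun.measurable_sample' 0) (hrun.indep_sample 0) (fun _ => measurable_const)
    fun _ _ => integrable_const _).2
  simpa [hrun.law_sample] using h.symm

theorem Run.law_act_nonneg (hrun : Run V η μ p q P ℱ act sample dir delay w) (m : Fin M) :
    0 ≤ p m := by
  rw [← hrun.law_act 0 m]; exact measureReal_nonneg

theorem Run.law_sample_nonneg (hrun : Run V η μ p q P ℱ act sample dir delay w) (i : Fin n) :
    0 ≤ q i := by
  rw [← hrun.law_sample 0 i]; exact measureReal_nonneg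

/-! ### The step of a client -/

/-- The error bound of the two-point estimator of client `m`. -/
noncomputable def zoError (d : Fin (M + 1) → ℕ) (μ : Fin M → ℝ) (K : ℝ) (m : Fin M) : ℝ :=
  d m.succ * μ m * K / 2

theorem Run.client_step_sub (hrun : Run V η μ p q P ℱ act sample dir delay w) (t : ℕ) (ω : Ω)
    (m : Fin M) :
    w (t + 1) ω m.succ - w t ω m.succ = if act t ω = m then
      -(η • zoEstimator (V.sampleLoss (sample t ω)) (μ m) m (usedParams sample delay w t ω)
        (dir t ω m)) else 0 := by
  rw [hrun.client_step]
  split_ifs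
  · rw [usedParams]; abel
  · simp

theorem Run.integral_activeGrad_inner [IsProbabilityMeasure P]
    (hrun : Run V η μ p q P ℱ act sample dir delay w) (hV : Regular V q K σ G)
    (hd : ∀ m : Fin M, 0 < d m.succ) (t : ℕ) (m : Fin M)
    {Y : Ω → EuclideanSpace ℝ (Fin (d m.succ))} (hY : Measurable[beforeDir ℱ act sample t] Y)
    (hYG : ∀ ω, ‖Y ω‖ ≤ G m) :
    Integrable (fun ω => (d m.succ : ℝ) * (⟪activeGrad V act sample delay w t m ω, dir t ω m⟫ *
        ⟪Y ω, dir t ω m⟫)) P ∧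
      ∫ ω, (d m.succ : ℝ) * (⟪activeGrad V act sample delay w t m ω, dir t ω m⟫ *
        ⟪Y ω, dir t ω m⟫) ∂P = ∫ ω, ⟪activeGrad V act sample delay w t m ω, Y ω⟫ ∂P :=
  integral_inner_mul_inner_of_indep (hrun.beforeDir_le t) (hd m) (hrun.measurable_dir' t m)
    (hrun.law_dir t m) (hrun.indep_dir t m) (hrun.measurable_activeGrad hV t m) hY
    (fun ω => hV.norm_activeGrad_le t m ω) hYG

theorem Run.integral_norm_client_step_sq_le [IsProbabilityMeasure P]
    (hrun : Run V η μ p q P ℱ act sample dir delay w) (hV : Regular V q K σ G)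
    (hd : ∀ m : Fin M, 0 < d m.succ) (hμ : ∀ m, 0 < μ m) (t : ℕ) (m : Fin M) :
    Integrable (fun ω => ‖w (t + 1) ω m.succ - w t ω m.succ‖ ^ 2) P ∧
      ∫ ω, ‖w (t + 1) ω m.succ - w t ω m.succ‖ ^ 2 ∂P ≤
        p m * (η ^ 2 * (2 * d m.succ * G m ^ 2 + 2 * zoError d μ K m ^ 2)) := by
  set A : Set Ω := {ω | act t ω = m} with hA
  set x := activeGrad V act sample delay w t m with hx
  have hAm : MeasurableSet A := hrun.measurableSet_act t m
  obtain ⟨hint, heq⟩ := hrun.integral_activeGrad_inner hV hd t m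
    (hrun.measurable_activeGrad hV t m) (fun ω => hV.norm_activeGrad_le t m ω)
  rw [← hx] at hint heq
  have hconst : Integrable (A.indicator fun _ => 2 * zoError d μ K m ^ 2) P :=
    (integrable_const _).indicator hAm
  have hbound : Integrable (fun ω => η ^ 2 * (2 * d m.succ *
      (d m.succ * (⟪x ω, dir t ω m⟫ * ⟪x ω, dir t ω m⟫))
      + A.indicator (fun _ => 2 * zoError d μ K m ^ 2) ω)) P :=
    ((hint.const_mul _).add hconst).const_mul _
  have hle : ∀ᵐ ω ∂P, ‖w (t + 1) ω m.succ - w t ω m.succ‖ ^ 2 ≤ η ^ 2 * (2 * d m.succ *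
      (d m.succ * (⟪x ω, dir t ω m⟫ * ⟪x ω, dir t ω m⟫))
      + A.indicator (fun _ => 2 * zoError d μ K m ^ 2) ω) := by
    filter_upwards [hrun.ae_norm_dir t m] with ω hω
    rw [hrun.client_step_sub]
    by_cases h : act t ω = m
    · rw [if_pos h, norm_neg, norm_smul, mul_pow, Real.norm_eq_abs, sq_abs,
        Set.indicator_of_mem (by exact h)]
      refine mul_le_mul_of_nonneg_left ?_ (sq_nonneg η)
      have hxω : x ω = partialGrad (V.sampleLoss (sample t ω)) m.succ
          (usedParams sample delay w t ω) := Set.indicator_of_mem (by exact h) _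
      rw [hxω]
      exact norm_sq_le_of_norm_sub_le hω (norm_zoEstimator_sub_le (hV.differentiable _)
        (hV.lipschitz _) (hμ m) m _ hω)
    · rw [if_neg h, Set.indicator_of_notMem (by exact h)]
      have hxω : x ω = 0 := Set.indicator_of_notMem (by exact h) _
      simp [hxω]
  have hmeas : Measurable fun ω => ‖w (t + 1) ω m.succ - w t ω m.succ‖ ^ 2 := by
    have hblock : Measurable fun v : Params d => v m.succ := Continuous.measurable (by fun_prop)
    exact (((hblock.comp (hrun.measurable_params (t + 1))).sub
      (hblock.comp (hrun.measurable_params t))).norm.pow_const 2)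
  have hI : Integrable (fun ω => ‖w (t + 1) ω m.succ - w t ω m.succ‖ ^ 2) P :=
    hbound.mono' hmeas.aestronglyMeasurable (by
      filter_upwards [hle] with ω hω
      rwa [Real.norm_of_nonneg (by positivity)])
  refine ⟨hI, (integral_mono_ae hI hbound hle).trans ?_⟩
  have hxx : ∫ ω, ⟪x ω, x ω⟫ ∂P ≤ p m * G m ^ 2 := by
    have hGint : Integrable (A.indicator fun _ => G m ^ 2) P := (integrable_const _).indicator hAm
    have hmx : Measurable x := (hrun.measurable_activeGrad hV t m).mono (hrun.beforeDir_le t) le_rfl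
    have hpt : ∀ ω, ⟪x ω, x ω⟫ ≤ A.indicator (fun _ => G m ^ 2) ω := fun ω => by
      rw [real_inner_self_eq_norm_sq]
      by_cases h : act t ω = m
      · rw [Set.indicator_of_mem (by exact h)]
        exact pow_le_pow_left₀ (norm_nonneg _) (hV.norm_activeGrad_le t m ω) 2
      · have hxω : x ω = 0 := Set.indicator_of_notMem (by exact h) _
        rw [hxω, Set.indicator_of_notMem (by exact h)]
        simp
    calc ∫ ω, ⟪x ω, x ω⟫ ∂P ≤ ∫ ω, A.indicator (fun _ => G m ^ 2) ω ∂P :=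
          integral_mono (hGint.mono' (hmx.inner hmx).aestronglyMeasurable
            (Filter.Eventually.of_forall fun ω => by
              rw [Real.norm_of_nonneg real_inner_self_nonneg]; exact hpt ω)) hGint hpt
      _ = p m * G m ^ 2 := by
          rw [integral_indicator_const _ hAm, hA, hrun.law_act, smul_eq_mul]
  rw [integral_const_mul, integral_add (hint.const_mul _) hconst, integral_const_mul, heq,
    integral_indicator_const _ hAm, hA, hrun.law_act, smul_eq_mul]
  calc _ ≤ η ^ 2 * (2 * d m.succ * (p m * G m ^ 2) + p m * (2 * zoError d μ K m ^ 2)) := by gcongr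
    _ = _ := by ring

theorem Run.integral_clientDrift_le [IsProbabilityMeasure P]
    (hrun : Run V η μ p q P ℱ act sample dir delay w) (hV : Regular V q K σ G)
    (hd : ∀ m : Fin M, 0 < d m.succ) (hμ : ∀ m, 0 < μ m) {κ : ℝ}
    (hκ : ∀ m, 2 * d m.succ * G m ^ 2 + 2 * zoError d μ K m ^ 2 ≤ κ) (s : ℕ) :
    Integrable (fun ω => clientDrift (fun s => w s ω) s) P ∧
      ∫ ω, clientDrift (fun s => w s ω) s ∂P ≤ η ^ 2 * κ := by
  have h := fun m => hrun.integral_norm_client_step_sq_le hV hd hμ s m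
  unfold clientDrift
  refine ⟨integrable_finsetSum _ fun m _ => (h m).1, ?_⟩
  rw [integral_finsetSum _ fun m _ => (h m).1]
  calc _ ≤ ∑ m, p m * (η ^ 2 * κ) := by
        refine Finset.sum_le_sum fun m _ => (h m).2.trans ?_
        have := hrun.law_act_nonneg m
        gcongr
        exact hκ m
    _ = η ^ 2 * κ := by rw [← Finset.sum_mul, hrun.sum_law_act, one_mul]

theorem Run.integral_staleness_le [IsProbabilityMeasure P]
    (hrun : Run V η μ p q P ℱ act sample dir delay w) (hV : Regular V q K σ G)
    (hd : ∀ m : Fin M, 0 < d m.succ) (hμ : ∀ m, 0 < μ m) {κ : ℝ} (hκ0 : 0 ≤ κ)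
    (hκ : ∀ m, 2 * d m.succ * G m ^ 2 + 2 * zoError d μ K m ^ 2 ≤ κ) (τ t : ℕ) :
    Integrable (fun ω => staleness (fun s => w s ω) τ t) P ∧
      ∫ ω, staleness (fun s => w s ω) τ t ∂P ≤ (τ : ℝ) ^ 2 * (η ^ 2 * κ) := by
  have h := fun s => hrun.integral_clientDrift_le hV hd hμ hκ s
  unfold staleness
  refine ⟨(integrable_finsetSum _ fun s _ => (h s).1).const_mul _, ?_⟩
  rw [integral_const_mul, integral_finsetSum _ fun s _ => (h s).1, sq, mul_assoc]
  refine mul_le_mul_of_nonneg_left ?_ (Nat.cast_nonneg _)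
  refine (Finset.sum_le_card_nsmul _ _ _ fun s _ => (h s).2).trans ?_
  rw [Nat.card_Ico, nsmul_eq_mul]
  refine mul_le_mul_of_nonneg_right ?_ (by positivity)
  exact_mod_cast (by omega : t - (t - τ) ≤ τ)

end Run

/-! ### Expected descent in one round -/

section Descent

open scoped RealInnerProductSpace

variable {M n : ℕ} {d : Fin (M + 1) → ℕ} {X C : Fin M → Type*} {Z Y : Type*}
  {V : Problem n d X C Z Y} {q : Fin n → ℝ} {K : ℝ} {σ : Fin (M + 1) → ℝ} {G : Fin M → ℝ}
  {η : ℝ} {μ p : Fin M → ℝ} {Ω : Type*} {mΩ : MeasurableSpace Ω} {P : Measure Ω}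
  {ℱ : Filtration ℕ mΩ} {act : ℕ → Ω → Fin M} {sample : ℕ → Ω → Fin n}
  {dir : ℕ → Ω → ∀ m : Fin M, EuclideanSpace ℝ (Fin (d m.succ))}
  {delay : ℕ → Ω → Fin n → Fin M → ℕ} {w : ℕ → Ω → Params d}

/-- The contribution of one block of parameters to the quadratic upper bound on the change of the
objective in round `t`. -/
noncomputable def blockChange (V : Problem n d X C Z Y) (K : ℝ) (w : ℕ → Ω → Params d) (t : ℕ)
    (m : Fin (M + 1)) (ω : Ω) : ℝ :=
  ⟪partialGrad V.objective m (w t ω), w (t + 1) ω m - w t ω m⟫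
    + K / 2 * ‖w (t + 1) ω m - w t ω m‖ ^ 2

/-- The first-order step of the server, bounded by a function of known mean. -/
theorem Run.exists_integrable_blockChange_zero_le [IsProbabilityMeasure P]
    (hrun : Run V η μ p q P ℱ act sample dir delay w) (hV : Regular V q K σ G) (hη : 0 ≤ η)
    (hKη : K * η ≤ 1 / 2) {t τ : ℕ}
    (hdelay : ∀ᵐ ω ∂P, ∀ i m, delay t ω i m ≤ τ)
    (hB : Integrable (fun ω => staleness (fun s => w s ω) τ t) P)
    (hg : Integrable (fun ω => ‖partialGrad V.objective 0 (w t ω)‖ ^ 2) P) :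
    ∃ U : Ω → ℝ, Integrable U P ∧ (∀ᵐ ω ∂P, blockChange V K w t 0 ω ≤ U ω) ∧
      ∫ ω, U ω ∂P ≤ η * (-(1 / 2) * ∫ ω, ‖partialGrad V.objective 0 (w t ω)‖ ^ 2 ∂P
        + 3 / 4 * K ^ 2 * ∫ ω, staleness (fun s => w s ω) τ t ∂P + K * η * σ 0 ^ 2) := by
  have hc : 0 ≤ K * η / 2 := by have := hV.pos; positivity
  have hS : Integrable (fun ω => K ^ 2 * staleness (fun s => w s ω) τ t) P := hB.const_mul _
  have hSm : Measurable[ℱ t] fun ω => K ^ 2 * staleness (fun s => w s ω) τ t :=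
    (measurable_staleness (m := ℱ t) (hrun.measurable_past t) τ).const_mul _
  obtain ⟨hint, heq⟩ := integral_eval_of_indep (P := P) (hrun.beforeSample_le t)
    (hrun.measurable_sample' t) (hrun.indep_sample t)
    (φ := fun i ω => progressBound V 0 (K * η / 2) i (K ^ 2 * staleness (fun s => w s ω) τ t)
      (w t ω))
    (fun i => (hV.measurable_progressBound (mΩ := ℱ t) (hrun.adapted t) hSm 0 _ i).mono
      le_sup_left le_rfl)
    (fun i hi => hV.integrable_progressBound (hrun.measurable_params t) hS hg _
      (by rwa [hrun.law_sample] at hi))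
  refine ⟨_, hint.const_mul η, ?_, ?_⟩
  · filter_upwards [hdelay] with ω hω
    have h := hV.neg_inner_add_le_progressBound hc (by linarith) 0 (sample t ω)
      (norm_delayedParams_sub_sq_le (fun s => w s ω) t (hω (sample t ω)))
    refine le_trans (le_of_eq ?_) (mul_le_mul_of_nonneg_left h hη)
    rw [blockChange, hrun.server_step, sub_sub_cancel_left, norm_neg, norm_smul, inner_neg_right,
      inner_smul_right, mul_pow, Real.norm_eq_abs, sq_abs]
    ring
  · rw [integral_const_mul, heq]
    simp only [hrun.law_sample]
    refine mul_le_mul_of_nonneg_left ?_ hη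
    refine (hV.sum_integral_progressBound_le (hrun.measurable_params t) hS hg hc).trans
      (le_of_eq ?_)
    rw [integral_const_mul]
    ring

/-- The zeroth-order step of a client, bounded by a function of known mean. -/
theorem Run.exists_integrable_blockChange_succ_le [IsProbabilityMeasure P]
    (hrun : Run V η μ p q P ℱ act sample dir delay w) (hV : Regular V q K σ G)
    (hd : ∀ m : Fin M, 0 < d m.succ) (hμ : ∀ m, 0 < μ m) (hη : 0 ≤ η) {m : Fin M}
    (hKη : K * η * d m.succ ≤ 1 / 4) {t τ : ℕ}
    (hdelay : ∀ᵐ ω ∂P, ∀ i m, delay t ω i m ≤ τ)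
    (hB : Integrable (fun ω => staleness (fun s => w s ω) τ t) P) :
    ∃ U : Ω → ℝ, Integrable U P ∧ (∀ᵐ ω ∂P, blockChange V K w t m.succ ω ≤ U ω) ∧
      ∫ ω, U ω ∂P ≤ p m *
        (η * (-(1 / 4) * ∫ ω, ‖partialGrad V.objective m.succ (w t ω)‖ ^ 2 ∂P
          + 3 / 4 * K ^ 2 * ∫ ω, staleness (fun s => w s ω) τ t ∂P
          + 2 * (K * η * d m.succ) * σ m.succ ^ 2 + zoError d μ K m ^ 2)
        + K * η ^ 2 * zoError d μ K m ^ 2) := by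
  have hc : 0 ≤ K * η * d m.succ := by have := hV.pos; positivity
  set c := K * η * d m.succ with hc_def
  set R := zoError d μ K m with hR
  set A : Set Ω := {ω | act t ω = m} with hA
  set x := activeGrad V act sample delay w t m with hx
  set g : Ω → EuclideanSpace ℝ (Fin (d m.succ)) :=
    fun ω => partialGrad V.objective m.succ (w t ω) with hg_def
  have hAm : MeasurableSet A := hrun.measurableSet_act t m
  have hxA : ∀ ω, act t ω = m → x ω = partialGrad (V.sampleLoss (sample t ω)) m.succ
      (usedParams sample delay w t ω) := fun ω h => Set.indicator_of_mem (by exact h) _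
  have hxA' : ∀ ω, act t ω ≠ m → x ω = 0 := fun ω h => Set.indicator_of_notMem (by exact h) _
  have hgm : Measurable[ℱ t] g :=
    (hV.continuous_objective m.succ).measurable.comp (hrun.adapted t)
  have hgG : ∀ ω, ‖g ω‖ ≤ G m := fun ω => hV.norm_objective_le m (w t ω)
  have hg : Integrable (fun ω => ‖g ω‖ ^ 2) P := by
    refine Integrable.of_bound
      ((hgm.mono (ℱ.le t) le_rfl).norm.pow_const 2).aestronglyMeasurable (G m ^ 2)
      (Filter.Eventually.of_forall fun ω => ?_)
    rw [Real.norm_of_nonneg (by positivity)]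
    exact pow_le_pow_left₀ (norm_nonneg _) (hgG ω) 2
  have hxG : ∀ ω, ‖x ω‖ ≤ G m := fun ω => hV.norm_activeGrad_le t m ω
  have hxm : Measurable x := (hrun.measurable_activeGrad hV t m).mono (hrun.beforeDir_le t) le_rfl
  obtain ⟨hxg, hxg_eq⟩ := hrun.integral_activeGrad_inner hV hd t m
    (hgm.mono (le_sup_left.trans le_sup_left) le_rfl) hgG
  obtain ⟨hxx, hxx_eq⟩ := hrun.integral_activeGrad_inner hV hd t m
    (hrun.measurable_activeGrad hV t m) hxG
  rw [← hx] at hxg hxg_eq hxx hxx_eq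
  -- the terms that do not involve the direction
  have hrest : Measurable[ℱ t] fun ω => η * (‖g ω‖ ^ 2 / 4 + R ^ 2) + K * η ^ 2 * R ^ 2 := by
    have h : Measurable fun y : EuclideanSpace ℝ (Fin (d m.succ)) =>
        η * (‖y‖ ^ 2 / 4 + R ^ 2) + K * η ^ 2 * R ^ 2 := by fun_prop
    exact h.comp hgm
  have hrestI : Integrable (fun ω => η * (‖g ω‖ ^ 2 / 4 + R ^ 2) + K * η ^ 2 * R ^ 2) P :=
    (((hg.div_const 4).add (integrable_const _)).const_mul _).add (integrable_const _)
  have hrest_eq : ∫ ω, (η * (‖g ω‖ ^ 2 / 4 + R ^ 2) + K * η ^ 2 * R ^ 2) ∂P =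
      η * ((∫ ω, ‖g ω‖ ^ 2 ∂P) / 4 + R ^ 2) + K * η ^ 2 * R ^ 2 := by
    have h : Integrable (fun ω => ‖g ω‖ ^ 2 / 4 + R ^ 2) P :=
      (hg.div_const 4).add (integrable_const _)
    rw [integral_add (h.const_mul _) (integrable_const _), integral_const_mul,
      integral_add (hg.div_const 4) (integrable_const _), integral_div]
    simp
  have hactm : MeasurableSet[MeasurableSpace.comap (act t) ⊤] A := ⟨{m}, trivial, rfl⟩
  obtain ⟨hrA, hrA_eq⟩ := integral_indicator_of_indep (P := P) (hrun.measurable_act' t).comap_le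
    (ℱ.le t) (hrun.indep_act t) hactm hrest fun _ => hrestI
  -- the terms that do are, in mean over the direction, those of the exact partial gradient
  have hS : Integrable (fun ω => K ^ 2 * staleness (fun s => w s ω) τ t) P := hB.const_mul _
  have hSm : Measurable[ℱ t] fun ω => K ^ 2 * staleness (fun s => w s ω) τ t :=
    (measurable_staleness (m := ℱ t) (hrun.measurable_past t) τ).const_mul _
  have hψm : ∀ i, Measurable[ℱ t] fun ω =>
      progressBound V m.succ c i (K ^ 2 * staleness (fun s => w s ω) τ t) (w t ω) := fun i =>
    hV.measurable_progressBound (mΩ := ℱ t) (hrun.adapted t) hSm m.succ c i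
  have hψI : ∀ i, q i ≠ 0 → Integrable (fun ω =>
      progressBound V m.succ c i (K ^ 2 * staleness (fun s => w s ω) τ t) (w t ω)) P := fun i hi =>
    hV.integrable_progressBound (hrun.measurable_params t) hS hg c hi
  obtain ⟨hψ, hψ_eq⟩ := integral_eval_of_indep (P := P) (hrun.beforeSample_le t)
    (hrun.measurable_sample' t) (hrun.indep_sample t)
    (φ := fun i => A.indicator fun ω =>
      progressBound V m.succ c i (K ^ 2 * staleness (fun s => w s ω) τ t) (w t ω))
    (fun i => Measurable.indicator (m := beforeSample ℱ act t)
      ((hψm i).mono le_sup_left le_rfl) (measurableSet_act_beforeSample t m))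
    (fun i hi => (hψI i (by rwa [hrun.law_sample] at hi)).indicator hAm)
  have hψ_le : ∫ ω, A.indicator (fun ω => progressBound V m.succ c (sample t ω)
        (K ^ 2 * staleness (fun s => w s ω) τ t) (w t ω)) ω ∂P ≤
      p m * (-(1 / 2) * ∫ ω, ‖g ω‖ ^ 2 ∂P + 3 / 4 * (K ^ 2 * ∫ ω, staleness (fun s => w s ω) τ t ∂P)
        + 2 * c * σ m.succ ^ 2) := by
    have hterm : ∀ i, q i * ∫ ω, A.indicator (fun ω => progressBound V m.succ c i
          (K ^ 2 * staleness (fun s => w s ω) τ t) (w t ω)) ω ∂P =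
        p m * (q i * ∫ ω, progressBound V m.succ c i
          (K ^ 2 * staleness (fun s => w s ω) τ t) (w t ω) ∂P) := fun i => by
      by_cases hi : q i = 0
      · simp [hi]
      · rw [(integral_indicator_of_indep (P := P) (hrun.measurable_act' t).comap_le
          (ℱ.le t) (hrun.indep_act t) hactm (hψm i) fun _ => hψI i hi).2, hA, hrun.law_act]
        ring
    have hcongr : ∀ ω, A.indicator (fun ω => progressBound V m.succ c (sample t ω)
        (K ^ 2 * staleness (fun s => w s ω) τ t) (w t ω)) ω =
        A.indicator (fun ω' => progressBound V m.succ c (sample t ω)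
        (K ^ 2 * staleness (fun s => w s ω') τ t) (w t ω')) ω := fun ω => by
      by_cases h : ω ∈ A <;> simp [h]
    simp only [hcongr]
    rw [hψ_eq]
    simp only [hrun.law_sample, hterm]
    rw [← Finset.mul_sum]
    refine mul_le_mul_of_nonneg_left ?_ (hrun.law_act_nonneg m)
    rw [← integral_const_mul (K ^ 2)]
    exact hV.sum_integral_progressBound_le (hrun.measurable_params t) hS hg hc
  have hψA : Integrable (A.indicator (fun ω => progressBound V m.succ c (sample t ω)
        (K ^ 2 * staleness (fun s => w s ω) τ t) (w t ω))) P := by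
    refine hψ.congr (Filter.Eventually.of_forall fun ω => ?_)
    by_cases h : ω ∈ A <;> simp [h]
  have hbil : ∀ Y : Ω → EuclideanSpace ℝ (Fin (d m.succ)), Measurable Y → (∀ ω, ‖Y ω‖ ≤ G m) →
      Integrable (fun ω => ⟪x ω, Y ω⟫) P := fun Y hY hYG => by
    refine Integrable.of_bound (hxm.inner hY).aestronglyMeasurable (G m * G m)
      (Filter.Eventually.of_forall fun ω => (norm_inner_le_norm _ _).trans ?_)
    exact mul_le_mul (hxG ω) (hYG ω) (norm_nonneg _) ((norm_nonneg _).trans (hxG ω))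
  have hbil_g := hbil g (hgm.mono (ℱ.le t) le_rfl) hgG
  have hbil_x := hbil x hxm hxG
  have hexact : -η * ∫ ω, ⟪x ω, g ω⟫ ∂P + K * η ^ 2 * d m.succ * ∫ ω, ⟪x ω, x ω⟫ ∂P ≤
      η * ∫ ω, A.indicator (fun ω => progressBound V m.succ c (sample t ω)
        (K ^ 2 * staleness (fun s => w s ω) τ t) (w t ω)) ω ∂P := by
    rw [← integral_const_mul, ← integral_const_mul, ← integral_const_mul,
      ← integral_add (hbil_g.const_mul _) (hbil_x.const_mul _)]
    refine integral_mono_ae ((hbil_g.const_mul _).add (hbil_x.const_mul _)) (hψA.const_mul _) ?_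
    filter_upwards [hdelay] with ω hω
    by_cases h : act t ω = m
    · rw [Set.indicator_of_mem (by exact h), hxA ω h]
      have h := hV.neg_inner_add_le_progressBound hc hKη m.succ (sample t ω)
        (norm_delayedParams_sub_sq_le (fun s => w s ω) t (hω (sample t ω)))
      refine le_trans (le_of_eq ?_) (mul_le_mul_of_nonneg_left h hη)
      rw [real_inner_comm, real_inner_self_eq_norm_sq, hc_def, usedParams, hg_def]
      ring
    · rw [Set.indicator_of_notMem (by exact h), hxA' ω h]
      simp
  have hlin : Integrable (fun ω => -η * (d m.succ * (⟪x ω, dir t ω m⟫ * ⟪g ω, dir t ω m⟫))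
      + K * η ^ 2 * d m.succ * (d m.succ * (⟪x ω, dir t ω m⟫ * ⟪x ω, dir t ω m⟫))) P :=
    (hxg.const_mul _).add (hxx.const_mul _)
  refine ⟨fun ω => -η * (d m.succ * (⟪x ω, dir t ω m⟫ * ⟪g ω, dir t ω m⟫))
    + K * η ^ 2 * d m.succ * (d m.succ * (⟪x ω, dir t ω m⟫ * ⟪x ω, dir t ω m⟫))
    + A.indicator (fun ω => η * (‖g ω‖ ^ 2 / 4 + R ^ 2) + K * η ^ 2 * R ^ 2) ω,
    hlin.add hrA, ?_, ?_⟩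
  · filter_upwards [hrun.ae_norm_dir t m] with ω hω
    rw [blockChange, hrun.client_step_sub]
    by_cases h : act t ω = m
    · rw [if_pos h, Set.indicator_of_mem (by exact h), hxA ω h]
      have h := neg_inner_add_norm_sq_le_of_norm_sub_le (g := g ω) hη hV.pos.le hω
        (norm_zoEstimator_sub_le (hV.differentiable (sample t ω))
          (hV.lipschitz _) (hμ m) m (usedParams sample delay w t ω) hω)
      rw [inner_neg_right, inner_smul_right, norm_neg, norm_smul, mul_pow, Real.norm_eq_abs, sq_abs]
      rw [hR, zoError]
      linarith
    · rw [if_neg h, Set.indicator_of_notMem (by exact h), hxA' ω h]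
      simp
  · rw [integral_add hlin hrA,
      integral_add (hxg.const_mul _) (hxx.const_mul _), integral_const_mul (-η),
      integral_const_mul (K * η ^ 2 * d m.succ),
      hxg_eq, hxx_eq, hrA_eq, hA, hrun.law_act, hrest_eq]
    have h := hexact.trans (mul_le_mul_of_nonneg_left hψ_le hη)
    refine (add_le_add_left h _).trans (le_of_eq ?_)
    ring

end Descent

/-! ### Telescoping -/

section Telescoping

open scoped RealInnerProductSpace

variable {M n : ℕ} {d : Fin (M + 1) → ℕ} {X C : Fin M → Type*} {Z Y : Type*}
  {V : Problem n d X C Z Y} {q : Fin n → ℝ} {K : ℝ} {σ : Fin (M + 1) → ℝ} {G : Fin M → ℝ}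
  {η : ℝ} {μ p : Fin M → ℝ} {Ω : Type*} {mΩ : MeasurableSpace Ω} {P : Measure Ω}
  {ℱ : Filtration ℕ mΩ} {act : ℕ → Ω → Fin M} {sample : ℕ → Ω → Fin n}
  {dir : ℕ → Ω → ∀ m : Fin M, EuclideanSpace ℝ (Fin (d m.succ))}
  {delay : ℕ → Ω → Fin n → Fin M → ℕ} {w : ℕ → Ω → Params d}

theorem Regular.continuous_value (hV : Regular V q K σ G) : Continuous V.objective :=
  (differentiable_objective V hV.differentiable).continuous

theorem Regular.integrable_norm_partialGrad_sq [IsFiniteMeasure P] (hV : Regular V q K σ G)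
    (hbdd : BddBelow (Set.range V.objective)) {v : Ω → Params d} (hv : Measurable v)
    (hint : Integrable (fun ω => V.objective (v ω)) P) (m : Fin (M + 1)) :
    Integrable (fun ω => ‖partialGrad V.objective m (v ω)‖ ^ 2) P := by
  obtain ⟨c, hc⟩ := hbdd
  refine ((hint.sub (integrable_const c)).const_mul (2 * K)).mono'
    (((hV.continuous_objective m).measurable.comp hv).norm.pow_const 2).aestronglyMeasurable
    (Filter.Eventually.of_forall fun ω => ?_)
  rw [Real.norm_of_nonneg (by positivity)]
  exact (pow_le_pow_left₀ (norm_nonneg _) (norm_block_le _ m) 2).trans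
    (norm_gradient_sq_le hV.pos (differentiable_objective V hV.differentiable)
      hV.lipschitz_objective (fun x => hc ⟨x, rfl⟩) (v ω))

/-- Descent in one round. The next objective value is integrable because it lies between the lower
bound of the objective and the integrable bound from smoothness. -/
theorem Run.integral_objective_succ_le [IsProbabilityMeasure P]
    (hrun : Run V η μ p q P ℱ act sample dir delay w) (hV : Regular V q K σ G)
    (hbdd : BddBelow (Set.range V.objective))
    (hd : ∀ m : Fin M, 0 < d m.succ) (hμ : ∀ m, 0 < μ m) (hη : 0 ≤ η) {D R s π : ℝ}
    (hD : ∀ m : Fin M, (d m.succ : ℝ) ≤ D) (hD1 : 1 ≤ D) (hKη : K * η * D ≤ 1 / 4)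
    (hR : ∀ m, zoError d μ K m ^ 2 ≤ R) (hs : ∀ m, σ m ^ 2 ≤ s)
    (hπ : ∀ m, π ≤ p m) (hπ1 : π ≤ 1) {t τ : ℕ}
    (hdelay : ∀ᵐ ω ∂P, ∀ i m, delay t ω i m ≤ τ)
    (hB : Integrable (fun ω => staleness (fun s => w s ω) τ t) P)
    (hint : Integrable (fun ω => V.objective (w t ω)) P) :
    Integrable (fun ω => V.objective (w (t + 1) ω)) P ∧
      ∫ ω, V.objective (w (t + 1) ω) ∂P ≤ ∫ ω, V.objective (w t ω) ∂P
        - η / 4 * π * ∫ ω, ‖gradient V.objective (w t ω)‖ ^ 2 ∂P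
        + (3 / 2 * η * K ^ 2 * ∫ ω, staleness (fun s => w s ω) τ t ∂P
          + K * η ^ 2 * s + 2 * K * D * η ^ 2 * s + η * R + K * η ^ 2 * R) := by
  have hK := hV.pos
  have hgI := fun m => hV.integrable_norm_partialGrad_sq hbdd (hrun.measurable_params t) hint m
  obtain ⟨U₀, hU₀, hU₀_le, hU₀_int⟩ := hrun.exists_integrable_blockChange_zero_le hV hη
    (by nlinarith [mul_nonneg hK.le hη]) hdelay hB (hgI 0)
  have hclient := fun m => hrun.exists_integrable_blockChange_succ_le hV hd hμ hη (m := m)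
    ((mul_le_mul_of_nonneg_left (hD m) (by positivity)).trans hKη) hdelay hB
  choose U hU hU_le hU_int using hclient
  have hbound : ∀ᵐ ω ∂P, V.objective (w (t + 1) ω) ≤
      V.objective (w t ω) + (U₀ ω + ∑ m, U m ω) := by
    filter_upwards [hU₀_le, ae_all_iff.2 hU_le] with ω h₀ h
    refine (le_add_sum_blocks_of_lipschitz_gradient
      (differentiable_objective V hV.differentiable) hV.lipschitz_objective (w t ω)
      (w (t + 1) ω)).trans ?_
    rw [Fin.sum_univ_succ]
    gcongr
    · exact h₀
    · exact h _
  have hUI : Integrable (fun ω => U₀ ω + ∑ m, U m ω) P :=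
    hU₀.add (integrable_finsetSum _ fun m _ => hU m)
  obtain ⟨c, hc⟩ := hbdd
  have hnext : Integrable (fun ω => V.objective (w (t + 1) ω)) P :=
    integrable_of_le_of_le
      (hV.continuous_value.measurable.comp (hrun.measurable_params (t + 1))).aestronglyMeasurable
      (Filter.Eventually.of_forall fun ω => hc ⟨w (t + 1) ω, rfl⟩) hbound
      (integrable_const c) (hint.add hUI)
  refine ⟨hnext, (integral_mono_ae hnext (hint.add hUI) hbound).trans ?_⟩
  rw [integral_add' hint hUI, integral_add hU₀ (integrable_finsetSum _ fun m _ => hU m),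
    integral_finsetSum _ fun m _ => hU m]
  simp only [norm_gradient_sq_eq_sum]
  rw [integral_finsetSum _ fun m _ => hgI m, Fin.sum_univ_succ]
  have hB0 : 0 ≤ ∫ ω, staleness (fun s => w s ω) τ t ∂P :=
    integral_nonneg fun ω => staleness_nonneg _ _ _
  have hg0 : ∀ m, 0 ≤ ∫ ω, ‖partialGrad V.objective m (w t ω)‖ ^ 2 ∂P := fun m =>
    integral_nonneg fun ω => by positivity
  set B := ∫ ω, staleness (fun s => w s ω) τ t ∂P
  set a := fun m => ∫ ω, ‖partialGrad V.objective m (w t ω)‖ ^ 2 ∂P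
  have hs0 : 0 ≤ s := (sq_nonneg _).trans (hs 0)
  have hserver : ∫ ω, U₀ ω ∂P ≤
      -(η / 4 * π * a 0) + 3 / 4 * η * K ^ 2 * B + K * η ^ 2 * s := by
    refine hU₀_int.trans ?_
    have h1 : η / 4 * π * a 0 ≤ η / 4 * 1 * a 0 := by gcongr
    have h2 : K * η * η * σ 0 ^ 2 ≤ K * η * η * s := by gcongr; exact hs 0
    nlinarith [mul_nonneg hη (hg0 0)]
  have hclients : ∑ m, ∫ ω, U m ω ∂P ≤ ∑ m : Fin M, (-(η / 4 * π * a m.succ) +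
      p m * (3 / 4 * η * K ^ 2 * B + 2 * K * D * η ^ 2 * s + η * R + K * η ^ 2 * R)) := by
    refine Finset.sum_le_sum fun m _ => (hU_int m).trans ?_
    have hp := hrun.law_act_nonneg m
    have h1 : η / 4 * π * a m.succ ≤ η / 4 * p m * a m.succ := by
      gcongr
      exact hπ m
    have h2 : η * (3 / 4 * K ^ 2 * B + 2 * (K * η * d m.succ) * σ m.succ ^ 2 + zoError d μ K m ^ 2)
        + K * η ^ 2 * zoError d μ K m ^ 2 ≤
        η * (3 / 4 * K ^ 2 * B + 2 * (K * η * D) * s + R) + K * η ^ 2 * R := by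
      gcongr
      · exact hD m
      · exact hs _
      · exact hR m
      · exact hR m
    have h3 := mul_le_mul_of_nonneg_left h2 hp
    change p m * (η * (-(1 / 4) * a m.succ + 3 / 4 * K ^ 2 * B
      + 2 * (K * η * d m.succ) * σ m.succ ^ 2 + zoError d μ K m ^ 2)
      + K * η ^ 2 * zoError d μ K m ^ 2) ≤ _
    linarith
  rw [Finset.sum_add_distrib, ← Finset.sum_mul, hrun.sum_law_act, Finset.sum_neg_distrib,
    ← Finset.mul_sum] at hclients
  linarith

/-- Descent summed over the first `t` rounds, with the staleness replaced by its bound. -/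
theorem Run.integrable_objective_and_sum_le [IsProbabilityMeasure P]
    (hrun : Run V η μ p q P ℱ act sample dir delay w) (hV : Regular V q K σ G)
    (hbdd : BddBelow (Set.range V.objective))
    (hd : ∀ m : Fin M, 0 < d m.succ) (hμ : ∀ m, 0 < μ m) (hη : 0 ≤ η) {D R s π κ : ℝ}
    (hD : ∀ m : Fin M, (d m.succ : ℝ) ≤ D) (hD1 : 1 ≤ D) (hKη : K * η * D ≤ 1 / 4)
    (hR : ∀ m, zoError d μ K m ^ 2 ≤ R) (hs : ∀ m, σ m ^ 2 ≤ s)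
    (hπ : ∀ m, π ≤ p m) (hπ1 : π ≤ 1) (hκ0 : 0 ≤ κ)
    (hκ : ∀ m, 2 * d m.succ * G m ^ 2 + 2 * zoError d μ K m ^ 2 ≤ κ) {T τ : ℕ}
    (hdelay : ∀ t < T, ∀ᵐ ω ∂P, ∀ i m, delay t ω i m ≤ τ)
    (hinit : Integrable (fun ω => V.objective (w 0 ω)) P) :
    ∀ t ≤ T, Integrable (fun ω => V.objective (w t ω)) P ∧
      ∫ ω, V.objective (w t ω) ∂P
        + η / 4 * π * ∑ j ∈ Finset.range t, ∫ ω, ‖gradient V.objective (w j ω)‖ ^ 2 ∂P ≤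
      ∫ ω, V.objective (w 0 ω) ∂P
        + t * (3 / 2 * η * K ^ 2 * ((τ : ℝ) ^ 2 * (η ^ 2 * κ))
          + K * η ^ 2 * s + 2 * K * D * η ^ 2 * s + η * R + K * η ^ 2 * R) := by
  intro t
  induction t with
  | zero => intro _; exact ⟨hinit, by simp⟩
  | succ t ih =>
    intro ht
    obtain ⟨hint, hle⟩ := ih (by omega)
    obtain ⟨hB, hB_le⟩ := hrun.integral_staleness_le hV hd hμ hκ0 hκ τ t
    obtain ⟨hnext, hstep⟩ := hrun.integral_objective_succ_le hV hbdd hd hμ hη hD hD1 hKη hR hs hπ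
      hπ1 (hdelay t ht) hB hint
    refine ⟨hnext, ?_⟩
    have h := mul_le_mul_of_nonneg_left hB_le (by positivity : 0 ≤ 3 / 2 * η * K ^ 2)
    rw [Finset.sum_range_succ, Nat.cast_succ]
    linarith

end Telescoping

end VFL

theorem theorem1 {M n : ℕ} (d : Fin (M + 1) → ℕ) (hd : ∀ m : Fin M, 0 < d m.succ)
    {X C : Fin M → Type*} {Z Y : Type*} (V : Problem n d X C Z Y)
    {Ω : Type*} [mΩ : MeasurableSpace Ω] (P : Measure Ω) [IsProbabilityMeasure P]
    (ℱ : Filtration ℕ mΩ)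
    (act : ℕ → Ω → Fin M) (sample : ℕ → Ω → Fin n)
    (dir : ℕ → Ω → ∀ m : Fin M, EuclideanSpace ℝ (Fin (d m.succ)))
    (delay : ℕ → Ω → Fin n → Fin M → ℕ) (w : ℕ → Ω → Params d)
    (η : ℝ) (μ : Fin M → ℝ) (p : Fin M → ℝ) (q : Fin n → ℝ) (T τ : ℕ)
    (L : ℝ) (Lp σ : Fin (M + 1) → ℝ) (G : Fin M → ℝ)
    (hη : 0 < η) (hμ : ∀ m, 0 < μ m) (hp : ∀ m, 0 < p m) (hT : 0 < T)
    -- the iterates are those of the algorithm; client activations are i.i.d. with law `p`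
    (hrun : Run V η μ p q P ℱ act sample dir delay w)
    -- the objective is bounded below
    (hbdd : BddBelow (Set.range V.objective))
    -- Lipschitz gradients
    (hdiff : ∀ i, Differentiable ℝ (V.sampleLoss i))
    (hL : ∀ i w₁ w₂, ‖gradient (V.sampleLoss i) w₁ - gradient (V.sampleLoss i) w₂‖
      ≤ L * ‖w₁ - w₂‖)
    (hLp_pos : ∀ m, 0 < Lp m)
    (hLp : ∀ m i w₁ w₂, ‖partialGrad (V.sampleLoss i) m w₁ - partialGrad (V.sampleLoss i) m w₂‖
      ≤ Lp m * ‖w₁ - w₂‖)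
    -- unbiased stochastic partial gradients
    (hunb : ∀ m v, ∑ i, q i • partialGrad (V.sampleLoss i) m v = partialGrad V.objective m v)
    -- bounded variance
    (hσ_nonneg : ∀ m, 0 ≤ σ m)
    (hσ : ∀ m v, ∑ i, q i * ‖partialGrad (V.sampleLoss i) m v - partialGrad V.objective m v‖ ^ 2
      ≤ σ m ^ 2)
    -- bounded client gradients
    (hG_pos : ∀ m, 0 < G m)
    (hG : ∀ (m : Fin M) i v, ‖partialGrad (V.sampleLoss i) m.succ v‖ ≤ G m)
    -- uniformly bounded delays
    (hdelay : ∀ t < T, ∀ i m, ∀ᵐ ω ∂P, delay t ω i m ≤ τ)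
    -- the initial loss has a finite expectation
    (hinit : Integrable (fun ω => V.objective (w 0 ω)) P)
    -- the constants of the bound
    (Lstar dstar pstar μstar σstar Gstar : ℝ)
    (hLstar : Lstar = max L (⨆ m : Fin (M + 1), Lp m))
    (hdstar : dstar = ⨆ m : Fin M, (d m.succ : ℝ))
    (hpstar : pstar = 1 / ⨅ m : Fin M, p m)
    (hμstar : μstar = ⨆ m : Fin M, μ m)
    (hσstar : σstar = ⨆ m : Fin (M + 1), σ m)
    (hGstar : Gstar = ⨆ m : Fin M, G m)
    (hη_le : η ≤ 1 / (4 * Lstar * dstar)) :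
    (∀ t < T, Integrable (fun ω => ‖gradient V.objective (w t ω)‖ ^ 2) P) ∧
    (1 / (T : ℝ)) * ∑ t ∈ Finset.range T, ∫ ω, ‖gradient V.objective (w t ω)‖ ^ 2 ∂P
      ≤ 4 * pstar * (∫ ω, (V.objective (w 0 ω) - ⨅ v, V.objective v) ∂P) / (T * η)
        + η * (4 * pstar * Lstar * σstar ^ 2 + 8 * pstar * Lstar * dstar * σstar ^ 2
            + pstar * Lstar ^ 3 * μstar ^ 2 * dstar ^ 2)
        + η ^ 2 * (18 * pstar * (τ : ℝ) ^ 2 * Lstar ^ 2 * dstar * Gstar ^ 2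
            + 5 * pstar * (τ : ℝ) ^ 2 * Lstar ^ 2 * μstar ^ 2 * Lstar ^ 2 * dstar ^ 2)
        + μstar ^ 2 * (pstar * Lstar ^ 2 * dstar ^ 2) := by
  have hΩ : Nonempty Ω := nonempty_of_isProbabilityMeasure P
  have hM : Nonempty (Fin M) := hΩ.map (act 0)
  have hdstar_le : ∀ m : Fin M, (d m.succ : ℝ) ≤ dstar := fun m =>
    hdstar ▸ le_ciSup (f := fun m : Fin M => (d m.succ : ℝ)) (Set.finite_range _).bddAbove m
  have hμ_le : ∀ m, μ m ≤ μstar := fun m => hμstar ▸ le_ciSup (Set.finite_range μ).bddAbove m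
  have hσ_le : ∀ m, σ m ≤ σstar := fun m => hσstar ▸ le_ciSup (Set.finite_range σ).bddAbove m
  have hG_le : ∀ m, G m ≤ Gstar := fun m => hGstar ▸ le_ciSup (Set.finite_range G).bddAbove m
  have hLp_le : ∀ m, Lp m ≤ Lstar := fun m =>
    hLstar ▸ (le_ciSup (Set.finite_range Lp).bddAbove m).trans (le_max_right _ _)
  have hL_le : L ≤ Lstar := hLstar ▸ le_max_left _ _
  have hK : 0 < Lstar := (hLp_pos 0).trans_le (hLp_le 0)
  obtain ⟨m₀⟩ := hM
  have hD1 : 1 ≤ dstar := le_trans (by exact_mod_cast hd m₀) (hdstar_le m₀)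
  obtain ⟨π, hπ⟩ : ∃ π, π = ⨅ m : Fin M, p m := ⟨_, rfl⟩
  have hπ_le : ∀ m, π ≤ p m := fun m => hπ ▸ ciInf_le (Set.finite_range p).bddBelow m
  have hπ0 : 0 < π := by
    have : Nonempty (Fin M) := ⟨m₀⟩
    obtain ⟨m, hm⟩ := exists_eq_ciInf_of_finite (f := p)
    rw [hπ, ← hm]
    exact hp m
  have hπ1 : π ≤ 1 := by
    refine (hπ_le m₀).trans ?_
    rw [← hrun.law_act 0 m₀]
    exact measureReal_le_one
  have hKη : Lstar * η * dstar ≤ 1 / 4 := by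
    rw [le_div_iff₀ (by positivity)] at hη_le
    linarith
  have hV : Regular V q Lstar σ G :=
    { pos := hK
      differentiable := hdiff
      lipschitz := fun i x y => (hL i x y).trans (by gcongr)
      unbiased := hunb
      variance := hσ
      bounded := hG
      law_nonneg := hrun.law_sample_nonneg
      law_sum := hrun.sum_law_sample }
  obtain ⟨R, hR⟩ : ∃ R, R = (dstar * μstar * Lstar / 2) ^ 2 := ⟨_, rfl⟩
  have hR_le : ∀ m, zoError d μ Lstar m ^ 2 ≤ R := fun m => by
    have h1 := (hμ m).le
    have h2 := hμ_le m
    have h3 := hdstar_le m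
    rw [hR, zoError]
    gcongr
  have hσ_sq : ∀ m, σ m ^ 2 ≤ σstar ^ 2 := fun m =>
    pow_le_pow_left₀ (hσ_nonneg m) (hσ_le m) 2
  have hκ : ∀ m, 2 * d m.succ * G m ^ 2 + 2 * zoError d μ Lstar m ^ 2 ≤
      2 * dstar * Gstar ^ 2 + 2 * R := fun m => by
    have h1 := (hG_pos m).le
    have h2 := hG_le m
    have h3 := hdstar_le m
    have h4 := hR_le m
    gcongr
  have hR0 : 0 ≤ R := hR ▸ sq_nonneg _
  have hmain := hrun.integrable_objective_and_sum_le hV hbdd hd hμ hη.le hdstar_le hD1 hKη hR_le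
    hσ_sq hπ_le hπ1 (by positivity) hκ (T := T) (τ := τ)
    (fun t ht => ae_all_iff.2 fun i => ae_all_iff.2 fun m => hdelay t ht i m) hinit
  refine ⟨fun t ht => ?_, ?_⟩
  · simp only [norm_gradient_sq_eq_sum]
    exact integrable_finsetSum _ fun m _ => hV.integrable_norm_partialGrad_sq hbdd
      (hrun.measurable_params t) (hmain t ht.le).1 m
  · obtain ⟨hT_int, hT_le⟩ := hmain T le_rfl
    have hlow : ⨅ v, V.objective v ≤ ∫ ω, V.objective (w T ω) ∂P := by
      have h := integral_mono (μ := P) (integrable_const (⨅ v, V.objective v)) hT_int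
        fun ω => ciInf_le hbdd (w T ω)
      simpa using h
    have hgap : ∫ ω, (V.objective (w 0 ω) - ⨅ v, V.objective v) ∂P =
        ∫ ω, V.objective (w 0 ω) ∂P - ⨅ v, V.objective v := by
      rw [integral_sub hinit (integrable_const _)]
      simp
    rw [hgap, hpstar, ← hπ]
    set S := ∑ t ∈ Finset.range T, ∫ ω, ‖gradient V.objective (w t ω)‖ ^ 2 ∂P
    set Δ := ∫ ω, V.objective (w 0 ω) ∂P - ⨅ v, V.objective v
    have hT' : (0 : ℝ) < T := Nat.cast_pos.2 hT
    set c := 3 / 2 * η * Lstar ^ 2 * ((τ : ℝ) ^ 2 * (η ^ 2 * (2 * dstar * Gstar ^ 2 + 2 * R)))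
      + Lstar * η ^ 2 * σstar ^ 2 + 2 * Lstar * dstar * η ^ 2 * σstar ^ 2 + η * R
      + Lstar * η ^ 2 * R with hc
    have hS : η / 4 * π * S ≤ Δ + T * c := by simp only [Δ]; linarith
    have hscale : 0 ≤ 4 * (1 / π) / (T * η) := by positivity
    have h1 := mul_le_mul_of_nonneg_left hS hscale
    have h2 : 4 * (1 / π) / (T * η) * (η / 4 * π * S) = 1 / T * S := by
      field_simp
    have h3 : 4 * (1 / π) / (T * η) * (Δ + T * c) =
        4 * (1 / π) * Δ / (T * η) + 1 / π * (4 * c / η) := by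
      field_simp
    have h4 : 4 * c / η = η * (4 * Lstar * σstar ^ 2 + 8 * Lstar * dstar * σstar ^ 2
          + Lstar ^ 3 * μstar ^ 2 * dstar ^ 2)
        + η ^ 2 * (12 * (τ : ℝ) ^ 2 * Lstar ^ 2 * dstar * Gstar ^ 2
          + 3 * (τ : ℝ) ^ 2 * Lstar ^ 2 * μstar ^ 2 * Lstar ^ 2 * dstar ^ 2)
        + μstar ^ 2 * (Lstar ^ 2 * dstar ^ 2) := by
      rw [hc, hR]
      field_simp
      ring
    rw [h2, h3, h4] at h1
    refine h1.trans ?_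
    -- the bound is met with room in the terms of order `η ^ 2`
    have hslack : 0 ≤ 1 / π * (η ^ 2 * (6 * (τ : ℝ) ^ 2 * Lstar ^ 2 * dstar * Gstar ^ 2
        + 2 * (τ : ℝ) ^ 2 * Lstar ^ 2 * μstar ^ 2 * Lstar ^ 2 * dstar ^ 2)) := by positivity
    linarith
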